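/- Let $M$ be a smooth finite-dimensional manifold without boundary, let $\tau:A\to M$ be a smooth real vector bundle of finite rank, and let $\bar\rho:A\to TM$ be an anchor, i.e. a smooth vector bundle morphism over $\mathrm{id}_M$. A smooth curve $\gamma:\mathbb{R}\to A$ is called *admissible* if $\bar\rho(\gamma(t))=\frac{d}{dt}(\tau\circ\gamma)(t)$ for all $t$. For a manifold $N$ let $T^kN$ be the bundle of $k$-jets at $0$ of smooth curves in $N$ (so $T^0N=N$, $T^1N=TN$), and for $k\ge 1$ let $TT^{k-1}N$ be the tangent bundle of $T^{k-1}N$, whose elements are the classes (velocities at $s=0$ of $s\mapsto j^{k-1}_{t=0}\chi(s,t)$) of smooth maps $\chi:\mathbb{R}^2\to N$, two maps being equivalent if they have the same value and the same partial derivatives $\partial_s^i\partial_t^j$, $i\le 1$, $j\le k-1$, at $(0,0)$. Embed $T^kN\subset TT^{k-1}N$ by $[\gamma]\mapsto[(s,t)\mapsto\gamma(s+t)]$, and identify $TT^{k-1}N\simeq T^{k-1}TN$ by $[\chi]\mapsto[t\mapsto\partial_s\chi(0,t)]$. Define subsets $A^k\subset T^{k-1}A$, $k\ge1$, inductively by $$A^1=A,\qquad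 A^2=\{Z\in TA \mid \bar\rho(\tau_A(Z))=T\tau(Z)\},\qquad A^{k+1}=TA^k\cap T^kA\subset TT^{k-1}A\quad(k\ge2),$$ where $\tau_A:TA\to A$ is the canonical projection and $TA^k\subset TT^{k-1}A$ is the set of vectors tangent to $A^k$, i.e. of velocities of smooth curves in $T^{k-1}A$ that lie in $A^k$. Then for every $k\ge1$: 1. $A^k$ is a smooth subbundle of $T^{k-1}A\to M$; more precisely, in the coordinates $(x,y,x',y',\dots,x^{(k-1)},y^{(k-1)})$ on $T^{k-1}A$ induced by a vector bundle chart $(x,y)$ of $A$ (base coordinates $x$, linear fibre coordinates $y$), $A^k$ is the graph of a smooth map $(x,y,y',\dots,y^{(k-1)})\mapsto(x',\dots,x^{(k-1)})$. 2. $A^k$ is the set of $(k-1)$-jets at $0$ of admissible curves in $A$. 3. $A^k=(T^{k-1}\bar\rho)^{-1}(T^kM)$, where $T^{k-1}\bar\rho$ is viewed as the map $T^{k-1}A\to T^{k-1}TM\simeq TT^{k-1}M$ and $T^kM\subset TT^{k-1}M$. -/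

import Mathlib

open Set Filter Topology Bundle
open scoped Manifold ContDiff

noncomputable section

namespace JetAnchor

section Jets

variable {V : Type*} [NormedAddCommGroup V] [NormedSpace ℝ V] {H : Type*} [TopologicalSpace H]
  (J : ModelWithCorners ℝ V H)
  (N : Type*) [TopologicalSpace N] [ChartedSpace H N]

/-- Smooth curves `ℝ → N`. -/
abbrev Curve := C^∞⟮𝓘(ℝ, ℝ), ℝ; J, N⟯

/-- Smooth maps `ℝ² → N`, `(s, t) ↦ χ (s, t)`. -/
abbrev Surface := C^∞⟮𝓘(ℝ, ℝ × ℝ), ℝ × ℝ; J, N⟯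

/-- Two curves have the same `k`-jet at `0`: same value at `0` and, in the chart around
this value, the same derivatives at `0` up to order `k`. -/
def jetSetoid (k : ℕ) : Setoid (Curve J N) where
  r γ δ := γ 0 = δ 0 ∧ ∀ i ≤ k,
    iteratedDeriv i (fun t => extChartAt J (γ 0) (γ t)) 0 =
      iteratedDeriv i (fun t => extChartAt J (γ 0) (δ t)) 0
  iseqv :=
    { refl := fun _ => ⟨rfl, fun _ _ => rfl⟩
      symm := fun {_ _} h => ⟨h.1.symm, fun i hi => by rw [← h.1]; exact (h.2 i hi).symm⟩
      trans := fun {γ δ _} h h' => ⟨h.1.trans h'.1, fun i hi => by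
        have h2 := h'.2 i hi
        rw [← h.1] at h2
        exact (h.2 i hi).trans h2⟩ }

/-- The higher tangent bundle `T^k N` of `k`-jets at `0` of smooth curves in `N`. -/
def Jet (k : ℕ) : Type _ := Quotient (jetSetoid J N k)

/-- The mixed partial derivative `∂ₜʲ ∂ₛⁱ χ (0, 0)` in the chart around `p`. -/
def mixedDeriv {N : Type*} [TopologicalSpace N] [ChartedSpace H N]
    (p : N) (i j : ℕ) (χ : Surface J N) : V :=
  iteratedDeriv j (fun t => iteratedDeriv i (fun s => extChartAt J p (χ (s, t))) 0) 0

/-- Two maps `ℝ² → N` have the same `(1, k)`-jet at `(0, 0)`: order at most `1` in the first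
variable `s`, order at most `k` in the second variable `t`. -/
def tangentJetSetoid (k : ℕ) : Setoid (Surface J N) where
  r χ ξ := χ (0, 0) = ξ (0, 0) ∧ ∀ i ≤ 1, ∀ j ≤ k,
    mixedDeriv J (χ (0, 0)) i j χ = mixedDeriv J (χ (0, 0)) i j ξ
  iseqv :=
    { refl := fun _ => ⟨rfl, fun _ _ _ _ => rfl⟩
      symm := fun {_ _} h =>
        ⟨h.1.symm, fun i hi j hj => by rw [← h.1]; exact (h.2 i hi j hj).symm⟩
      trans := fun {χ ξ _} h h' => ⟨h.1.trans h'.1, fun i hi j hj => by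
        have h2 := h'.2 i hi j hj
        rw [← h.1] at h2
        exact (h.2 i hi j hj).trans h2⟩ }

/-- The tangent bundle `T T^k N` of `T^k N`: the class of `χ` is the tangent vector at `s = 0`
of the curve `s ↦ [t ↦ χ (s, t)]` in `T^k N`. -/
def TangentJet (k : ℕ) : Type _ := Quotient (tangentJetSetoid J N k)

variable {J N}

/-- The `k`-jet of a curve at `0`. -/
def Jet.mk (k : ℕ) (γ : Curve J N) : Jet J N k := Quotient.mk (jetSetoid J N k) γ

/-- The element of `T T^k N` represented by a map `ℝ² → N`. -/
def TangentJet.mk (k : ℕ) (χ : Surface J N) : TangentJet J N k :=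
  Quotient.mk (tangentJetSetoid J N k) χ

/-- The point of `N` over which a jet lies. -/
def Jet.base {k : ℕ} : Jet J N k → N :=
  Quotient.lift (fun γ : Curve J N => γ 0) fun _ _ h => h.1

/-- The curve `t ↦ χ (s, t)`. -/
def Surface.slice (χ : Surface J N) (s : ℝ) : Curve J N :=
  χ.comp ⟨fun t => (s, t), (contDiff_const.prodMk contDiff_id).contMDiff⟩

/-- The map `(s, t) ↦ γ (s + t)`. -/
def Curve.shift (γ : Curve J N) : Surface J N :=
  γ.comp ⟨fun z : ℝ × ℝ => z.1 + z.2, (contDiff_fst.add contDiff_snd).contMDiff⟩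

/-- The set of vectors in `T T^k N` tangent to a subset `S` of `T^k N`, that is, the set of
velocities of smooth curves in `T^k N` lying in `S`. For a submanifold `S` this is `T S`. -/
def tangentSet {k : ℕ} (S : Set (Jet J N k)) : Set (TangentJet J N k) :=
  {z | ∃ χ : Surface J N, (∀ s, Jet.mk k (χ.slice s) ∈ S) ∧ TangentJet.mk k χ = z}

/-! Smooth maps preserve jets. -/

theorem iteratedDeriv_comp_congr {W : Type*} [NormedAddCommGroup W] [NormedSpace ℝ W]
    {g : V → W} {u v : ℝ → V} {k : ℕ} (hu : ContDiffAt ℝ k u 0) (hv : ContDiffAt ℝ k v 0)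
    (hg : ContDiffAt ℝ k g (u 0))
    (h : ∀ i ≤ k, iteratedDeriv i u 0 = iteratedDeriv i v 0) :
    ∀ i ≤ k, iteratedDeriv i (g ∘ u) 0 = iteratedDeriv i (g ∘ v) 0 := by
  intro i hi
  have h0 : u 0 = v 0 := by simpa using h 0 (Nat.zero_le _)
  have hik : (i : WithTop ℕ∞) ≤ k := by exact_mod_cast hi
  rw [iteratedDeriv_eq_iteratedFDeriv, iteratedDeriv_eq_iteratedFDeriv,
    iteratedFDeriv_comp hg hu hik, iteratedFDeriv_comp (h0 ▸ hg) hv hik]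
  congr 1
  rw [h0]
  simp only [FormalMultilinearSeries.taylorComp]
  refine Finset.sum_congr rfl fun c _ => ?_
  ext
  simp only [FormalMultilinearSeries.compAlongOrderedFinpartition_apply]
  congr 1
  ext n
  simp only [OrderedFinpartition.applyOrderedFinpartition_apply, ftaylorSeries]
  have hle : c.partSize n ≤ k := (c.partSize_le n).trans hi
  rw [iteratedFDeriv_apply_eq_iteratedDeriv_mul_prod,
    iteratedFDeriv_apply_eq_iteratedDeriv_mul_prod, h _ hle]

theorem contDiffAt_chart [IsManifold J ∞ N] {X : Type*} [NormedAddCommGroup X] [NormedSpace ℝ X]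
    {f : X → N} {x : X} (hf : ContMDiffAt 𝓘(ℝ, X) J ∞ f x) {p : N}
    (hp : f x ∈ (extChartAt J p).source) :
    ContDiffAt ℝ ∞ (fun y => extChartAt J p (f y)) x := by
  rw [extChartAt_source] at hp
  exact ((contMDiffAt_extChartAt' (n := ∞) hp).comp x hf).contDiffAt

variable {V' : Type*} [NormedAddCommGroup V'] [NormedSpace ℝ V'] {H' : Type*}
  [TopologicalSpace H'] {J' : ModelWithCorners ℝ V' H'}
  {N' : Type*} [TopologicalSpace N'] [ChartedSpace H' N']

theorem eventually_mem_source {X : Type*} [TopologicalSpace X] {f : X → N} {x : X}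
    (hf : ContinuousAt f x) {p : N} (hp : f x ∈ (extChartAt J p).source) :
    ∀ᶠ y in 𝓝 x, f y ∈ (extChartAt J p).source :=
  hf.eventually ((isOpen_extChartAt_source p).mem_nhds hp)

theorem jet_comp_congr [J.Boundaryless] [IsManifold J ∞ N] [IsManifold J' ∞ N']
    (f : C^∞⟮J, N; J', N'⟯) {k : ℕ} {γ δ : Curve J N} (h : jetSetoid J N k γ δ) :
    jetSetoid J' N' k (f.comp γ) (f.comp δ) := by
  obtain ⟨h0, h⟩ := h
  refine ⟨congrArg f h0, ?_⟩
  set p : N := γ 0 with hp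
  set g : V → V' := fun v => extChartAt J' (f p) (f ((extChartAt J p).symm v)) with hg
  have hgs : ContDiffAt ℝ ∞ g (extChartAt J p p) := by
    have h1 : ContMDiffAt 𝓘(ℝ, V) J ∞ (extChartAt J p).symm (extChartAt J p p) :=
      (contMDiffOn_extChartAt_symm p).contMDiffAt (extChartAt_target_mem_nhds p)
    refine contDiffAt_chart (f := fun v => f ((extChartAt J p).symm v))
      (f.contMDiff.contMDiffAt.comp _ h1) ?_
    rw [extChartAt_to_inv]
    exact mem_extChartAt_source _
  have key : ∀ ε : Curve J N, ε 0 = p →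
      (fun t => extChartAt J' (f p) (f (ε t))) =ᶠ[𝓝 0]
        g ∘ (fun t => extChartAt J p (ε t)) := by
    intro ε hε
    have hs : ε 0 ∈ (extChartAt J p).source := hε ▸ mem_extChartAt_source _
    filter_upwards [eventually_mem_source ε.contMDiff.continuous.continuousAt hs] with t ht
    simp only [hg, Function.comp_apply, (extChartAt J p).left_inv ht]
  have hsm : ∀ ε : Curve J N, ε 0 = p →
      ContDiffAt ℝ k (fun t => extChartAt J p (ε t)) 0 := fun ε hε =>
    (contDiffAt_chart ε.contMDiff.contMDiffAt (hε ▸ mem_extChartAt_source _)).of_le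
      (by exact_mod_cast le_top)
  intro i hi
  have e1 := (key γ rfl).iteratedDeriv_eq i
  have e2 := (key δ h0.symm).iteratedDeriv_eq i
  have := iteratedDeriv_comp_congr (g := g) (hsm γ rfl) (hsm δ h0.symm)
    (hgs.of_le (by exact_mod_cast le_top)) h i hi
  change iteratedDeriv i (fun t => extChartAt J' (f p) (f (γ t))) 0 =
    iteratedDeriv i (fun t => extChartAt J' (f p) (f (δ t))) 0
  rw [e1, e2, this]

/-- The map `T^k f : T^k N → T^k N'` induced by a smooth map `f : N → N'`. -/
def Jet.map [J.Boundaryless] [IsManifold J ∞ N] [IsManifold J' ∞ N'] (k : ℕ)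
    (f : C^∞⟮J, N; J', N'⟯) : Jet J N k → Jet J' N' k :=
  Quotient.map (fun γ => f.comp γ) fun _ _ h => jet_comp_congr f h

/-! The canonical embedding `T^{k+1} N → T T^k N`. -/

theorem shift_zero (γ : Curve J N) : γ.shift (0, 0) = γ 0 :=
  congrArg γ (add_zero (0 : ℝ))

theorem mixedDeriv_shift (γ : Curve J N) (p : N) (i j : ℕ) :
    mixedDeriv J p i j γ.shift =
      iteratedDeriv (i + j) (fun t => extChartAt J p (γ t)) 0 := by
  have h1 : ∀ t : ℝ, iteratedDeriv i (fun s => extChartAt J p (γ.shift (s, t))) 0 =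
      iteratedDeriv i (fun t => extChartAt J p (γ t)) t := by
    intro t
    have := congrFun (iteratedDeriv_comp_add_const i (fun t => extChartAt J p (γ t)) t) 0
    rw [zero_add] at this
    exact this
  simp only [mixedDeriv, h1]
  rw [add_comm, iteratedDeriv_eq_iterate, iteratedDeriv_eq_iterate, iteratedDeriv_eq_iterate,
    Function.iterate_add_apply]

/-- The canonical embedding `T^{k+1} N → T T^k N`, `[γ] ↦ [(s, t) ↦ γ (s + t)]`: it sends the
`(k+1)`-jet of `γ` to the velocity at `s = 0` of the `k`-th prolongation of `γ`. -/
def Jet.holonomic (k : ℕ) : Jet J N (k + 1) → TangentJet J N k :=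
  Quotient.map Curve.shift fun γ δ h => by
    refine ⟨by rw [shift_zero, shift_zero]; exact h.1, fun i hi j hj => ?_⟩
    rw [mixedDeriv_shift, mixedDeriv_shift, shift_zero]
    exact h.2 _ (by omega)

theorem Jet.holonomic_injective (k : ℕ) :
    Function.Injective (Jet.holonomic k : Jet J N (k + 1) → TangentJet J N k) := by
  rintro ⟨γ⟩ ⟨δ⟩ h
  obtain ⟨h0, h⟩ : tangentJetSetoid J N k γ.shift δ.shift := Quotient.exact h
  rw [shift_zero, shift_zero] at h0
  refine Quotient.sound (s := jetSetoid J N (k + 1)) ⟨h0, fun i hi => ?_⟩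
  rcases i with _ | i
  · simpa [mixedDeriv_shift, shift_zero] using h 0 (by omega) 0 (by omega)
  · have := h 1 le_rfl i (by omega)
    rwa [mixedDeriv_shift, mixedDeriv_shift, shift_zero, add_comm] at this

/-! Velocities. -/

/-- The tangent prolongation `t ↦ γ'(t) ∈ TN` of a curve. -/
def Curve.velocity (γ : Curve J N) (t : ℝ) : TangentBundle J N :=
  ⟨γ t, mfderiv 𝓘(ℝ, ℝ) J γ t (1 : ℝ)⟩

theorem velocity_congr [IsManifold J ∞ N] {γ δ : Curve J N} (h : jetSetoid J N 1 γ δ) :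
    γ.velocity 0 = δ.velocity 0 := by
  obtain ⟨h0, h⟩ := h
  have key : ∀ ε : Curve J N,
      ε.velocity 0 = ⟨ε 0, (deriv (fun t => extChartAt J (ε 0) (ε t)) 0 : V)⟩ := by
    intro ε
    have hm : MDifferentiableAt 𝓘(ℝ, ℝ) J ε 0 :=
      ε.contMDiff.contMDiffAt.mdifferentiableAt (by simp)
    simp only [Curve.velocity]
    rw [hm.mfderiv, ModelWithCorners.Boundaryless.range_eq_univ, fderivWithin_univ]
    rfl
  have h1 := h 1 le_rfl
  simp only [iteratedDeriv_one] at h1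
  rw [key, key, ← h0, h1]

/-- The identification `T^1 N → TN`, `[γ] ↦ γ'(0)`. -/
def Jet.velocity [IsManifold J ∞ N] : Jet J N 1 → TangentBundle J N :=
  Quotient.lift (fun γ : Curve J N => γ.velocity 0) fun _ _ h => velocity_congr h

/-! The canonical isomorphism `T T^k N ≃ T^k TN`. -/

/-- The curve `t ↦ ∂ₛ χ (0, t)` in `TN`. -/
def Surface.partialS [IsManifold J ∞ N] (χ : Surface J N) :
    Curve J.tangent (TangentBundle J N) :=
  ⟨fun t => ⟨χ (0, t), mfderiv 𝓘(ℝ, ℝ × ℝ) J χ (0, t) ((1, 0) : ℝ × ℝ)⟩, by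
    have h2 : ContMDiff 𝓘(ℝ, ℝ) 𝓘(ℝ, ℝ × ℝ).tangent ∞
        (fun t : ℝ => (⟨(0, t), ((1, 0) : ℝ × ℝ)⟩ : TangentBundle 𝓘(ℝ, ℝ × ℝ) (ℝ × ℝ))) := by
      intro t
      rw [contMDiffAt_totalSpace]
      refine ⟨(contDiff_const.prodMk contDiff_id).contMDiff.contMDiffAt, ?_⟩
      simp only [trivializationAt_model_space_apply]
      exact contMDiffAt_const
    exact (χ.contMDiff.contMDiff_tangentMap (m := ∞) (by simp)).comp h2⟩

theorem extChartAt_tangent [IsManifold J ∞ N] (p q : TangentBundle J N)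
    (h : q.proj ∈ (chartAt H p.proj).source) :
    extChartAt J.tangent p q = (extChartAt J p.proj q.proj,
      (mfderiv J 𝓘(ℝ, V) (extChartAt J p.proj) q.proj q.2 : V)) := by
  have : IsManifold J 1 N := IsManifold.of_le (n := ∞) (by exact_mod_cast le_top)
  rw [FiberBundle.extChartAt]
  have h' : q.proj ∈ (trivializationAt V (TangentSpace J) p.proj).baseSet := h
  refine Prod.ext rfl ?_
  have e := congrArg (fun L : V →L[ℝ] V => L q.2)
    (TangentBundle.continuousLinearMapAt_trivializationAt (I := J) h)
  refine Eq.trans ?_ e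
  change ((trivializationAt V (TangentSpace J) p.proj) q).2 =
    (trivializationAt V (TangentSpace J) p.proj).continuousLinearMapAt ℝ q.proj q.2
  rw [Bundle.Trivialization.continuousLinearMapAt_apply,
    Bundle.Trivialization.linearMapAt_apply, if_pos h']

theorem partialS_chart [IsManifold J ∞ N] (χ : Surface J N) (p : TangentBundle J N)
    (hp : χ (0, 0) ∈ (extChartAt J p.proj).source) :
    (fun t => extChartAt J.tangent p (χ.partialS t)) =ᶠ[𝓝 0] fun t =>
      (extChartAt J p.proj (χ (0, t)), deriv (fun s => extChartAt J p.proj (χ (s, t))) 0) := by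
  have hc : ContinuousAt (fun t : ℝ => χ (0, t)) 0 :=
    (χ.contMDiff.continuous.comp (by fun_prop)).continuousAt
  filter_upwards [eventually_mem_source hc hp] with t ht
  have ht' : χ (0, t) ∈ (chartAt H p.proj).source := by rwa [extChartAt_source] at ht
  rw [extChartAt_tangent p (χ.partialS t) ht']
  refine Prod.ext rfl ?_
  have hχ : MDifferentiableAt 𝓘(ℝ, ℝ × ℝ) J χ (0, t) :=
    χ.contMDiff.contMDiffAt.mdifferentiableAt (by simp)
  have : IsManifold J 1 N := IsManifold.of_le (n := ∞) (by exact_mod_cast le_top)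
  have hφ : MDifferentiableAt J 𝓘(ℝ, V) (extChartAt J p.proj) (χ (0, t)) :=
    mdifferentiableAt_extChartAt ht'
  have e := mfderiv_comp (0, t) hφ hχ
  have hd : DifferentiableAt ℝ (fun z => extChartAt J p.proj (χ z)) (0, t) :=
    (contDiffAt_chart χ.contMDiff.contMDiffAt ht).differentiableAt (by simp)
  rw [mfderiv_eq_fderiv] at e
  have hl : HasDerivAt (fun s : ℝ => (s, t)) ((1, 0) : ℝ × ℝ) 0 :=
    (hasDerivAt_id (0 : ℝ)).prodMk (hasDerivAt_const (0 : ℝ) t)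
  have h3 := (hd.hasFDerivAt.comp_hasDerivAt (0 : ℝ) hl).deriv
  have e' := congrArg (fun L : ℝ × ℝ →L[ℝ] V => L (1, 0)) e
  exact e'.symm.trans h3.symm

theorem iteratedDeriv_clm {X Y : Type*} [NormedAddCommGroup X] [NormedSpace ℝ X]
    [NormedAddCommGroup Y] [NormedSpace ℝ Y] (L : X →L[ℝ] Y) {f : ℝ → X} {x : ℝ}
    (hf : ContDiffAt ℝ ∞ f x) (i : ℕ) :
    iteratedDeriv i (fun t => L (f t)) x = L (iteratedDeriv i f x) := by
  rw [iteratedDeriv_eq_iteratedFDeriv, iteratedDeriv_eq_iteratedFDeriv]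
  have := L.iteratedFDeriv_comp_left (i := i) hf (by exact_mod_cast le_top)
  change iteratedFDeriv ℝ i (L ∘ f) x _ = _
  rw [this]
  rfl

theorem partialS_iteratedDeriv [IsManifold J ∞ N] (χ : Surface J N) (p : TangentBundle J N)
    (hp : χ (0, 0) ∈ (extChartAt J p.proj).source) (j : ℕ) :
    iteratedDeriv j (fun t => extChartAt J.tangent p (χ.partialS t)) 0 =
      (mixedDeriv J p.proj 0 j χ, mixedDeriv J p.proj 1 j χ) := by
  have hs : χ.partialS 0 ∈ (extChartAt J.tangent p).source := by
    rw [extChartAt_source] at hp ⊢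
    exact (TangentBundle.mem_chart_source_iff (χ.partialS 0) p).2 hp
  have hc := contDiffAt_chart (J := J.tangent) χ.partialS.contMDiff.contMDiffAt hs
  have he := partialS_chart χ p hp
  refine Prod.ext ?_ ?_
  · rw [← ContinuousLinearMap.coe_fst' (R := ℝ), ← iteratedDeriv_clm _ hc]
    refine (he.fun_comp Prod.fst).iteratedDeriv_eq j |>.trans ?_
    simp [mixedDeriv, Function.comp_def]
  · rw [← ContinuousLinearMap.coe_snd' (R := ℝ), ← iteratedDeriv_clm _ hc]
    refine (he.fun_comp Prod.snd).iteratedDeriv_eq j |>.trans ?_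
    simp [mixedDeriv, Function.comp_def]

theorem partialS_congr [IsManifold J ∞ N] {k : ℕ} {χ ξ : Surface J N}
    (h : tangentJetSetoid J N k χ ξ) :
    jetSetoid J.tangent (TangentBundle J N) k χ.partialS ξ.partialS := by
  obtain ⟨h0, h⟩ := h
  have hc : ∀ j ≤ k, iteratedDeriv j
      (fun t => extChartAt J.tangent (χ.partialS 0) (χ.partialS t)) 0 =
      iteratedDeriv j (fun t => extChartAt J.tangent (χ.partialS 0) (ξ.partialS t)) 0 := by
    intro j hj
    have hp : χ (0, 0) ∈ (extChartAt J (χ.partialS 0).proj).source :=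
      mem_extChartAt_source (χ (0, 0))
    rw [partialS_iteratedDeriv χ _ hp, partialS_iteratedDeriv ξ _ (h0 ▸ hp)]
    exact Prod.ext (h 0 (by omega) j hj) (h 1 le_rfl j hj)
  refine ⟨?_, hc⟩
  have e := hc 0 (Nat.zero_le _)
  simp only [iteratedDeriv_zero] at e
  refine (extChartAt J.tangent (χ.partialS 0)).injOn (mem_extChartAt_source _) ?_ e
  rw [extChartAt_source]
  refine (TangentBundle.mem_chart_source_iff _ _).2 ?_
  change ξ (0, 0) ∈ (chartAt H (χ (0, 0))).source
  rw [h0]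
  exact mem_chart_source H _

/-- The canonical map `T T^k N → T^k TN`, `[χ] ↦ [t ↦ ∂ₛ χ (0, t)]`. -/
def kappa [IsManifold J ∞ N] (k : ℕ) :
    TangentJet J N k → Jet J.tangent (TangentBundle J N) k :=
  Quotient.map Surface.partialS fun _ _ h => partialS_congr h

theorem kappa_injective [IsManifold J ∞ N] (k : ℕ) :
    Function.Injective (kappa k : TangentJet J N k → Jet J.tangent (TangentBundle J N) k) := by
  rintro ⟨χ⟩ ⟨ξ⟩ h
  obtain ⟨h0, h⟩ : jetSetoid J.tangent (TangentBundle J N) k χ.partialS ξ.partialS :=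
    Quotient.exact h
  have h0' : χ (0, 0) = ξ (0, 0) := congrArg TotalSpace.proj h0
  refine Quotient.sound (s := tangentJetSetoid J N k) ⟨h0', fun i hi j hj => ?_⟩
  have hp : χ (0, 0) ∈ (extChartAt J (χ.partialS 0).proj).source :=
    mem_extChartAt_source (χ (0, 0))
  have e := h j hj
  rw [partialS_iteratedDeriv χ _ hp, partialS_iteratedDeriv ξ _ (h0' ▸ hp)] at e
  interval_cases i
  · exact congrArg Prod.fst e
  · exact congrArg Prod.snd e

/-- A map that is smooth near `0` agrees near `0` with a globally defined smooth map. -/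
theorem exists_global {X : Type*} [NormedAddCommGroup X] [NormedSpace ℝ X] [HasContDiffBump X]
    {f : X → N} (hf : ∀ᶠ z in 𝓝 0, ContMDiffAt 𝓘(ℝ, X) J ∞ f z) :
    ∃ g : C^∞⟮𝓘(ℝ, X), X; J, N⟯, ∀ᶠ z in 𝓝 0, g z = f z := by
  obtain ⟨ε, hε, hf⟩ := Metric.eventually_nhds_iff.1 hf
  let b : ContDiffBump (0 : X) := ⟨ε / 2, ε, by positivity, by linarith⟩
  have hθ : ∀ z : X, dist (b z • z) 0 < ε := by
    intro z
    by_cases hz : dist z 0 < ε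
    · rw [dist_zero_right] at hz ⊢
      rw [norm_smul, Real.norm_of_nonneg b.nonneg]
      exact (mul_le_of_le_one_left (norm_nonneg _) b.le_one).trans_lt hz
    · rw [b.zero_of_le_dist (not_lt.1 hz)]
      simpa using hε
  have hs : ContMDiff 𝓘(ℝ, X) 𝓘(ℝ, X) ∞ (fun z : X => b z • z) :=
    (b.contDiff.smul contDiff_id).contMDiff
  refine ⟨⟨fun z => f (b z • z), fun z =>
    (hf (hθ z)).comp (f := fun z : X => b z • z) z hs.contMDiffAt⟩, ?_⟩
  filter_upwards [b.eventuallyEq_one] with z hz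
  change f (b z • z) = f z
  rw [hz]
  simp

theorem kappa_surjective [J.Boundaryless] [IsManifold J ∞ N] (k : ℕ) :
    Function.Surjective (kappa k : TangentJet J N k → Jet J.tangent (TangentBundle J N) k) := by
  rintro ⟨c⟩
  set p : TangentBundle J N := c 0 with hp
  set φ := extChartAt J p.proj with hφ
  set a : ℝ → V × V := fun t => extChartAt J.tangent p (c t) with ha
  set q : ℝ × ℝ → V := fun z => (a z.2).1 + z.1 • (a z.2).2 with hq
  have hsrc : ∀ᶠ t in 𝓝 (0 : ℝ), c t ∈ (extChartAt J.tangent p).source :=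
    eventually_mem_source c.contMDiff.continuous.continuousAt (mem_extChartAt_source _)
  have hsnd : Tendsto (fun z : ℝ × ℝ => z.2) (𝓝 0) (𝓝 0) := continuous_snd.tendsto' _ _ rfl
  have hqs : ∀ᶠ z in 𝓝 (0 : ℝ × ℝ), ContDiffAt ℝ ∞ q z := by
    filter_upwards [hsnd.eventually hsrc] with z hz
    have h1 : ContDiffAt ℝ ∞ a z.2 := contDiffAt_chart c.contMDiff.contMDiffAt hz
    have h2 : ContDiffAt ℝ ∞ (fun z : ℝ × ℝ => a z.2) z := h1.comp z contDiffAt_snd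
    exact h2.fst.add (contDiffAt_fst.smul h2.snd)
  have a0 : (a 0).1 = φ p.proj := rfl
  have hq0 : q 0 = φ p.proj := by simp [hq, a0]
  have hqt : ∀ᶠ z in 𝓝 (0 : ℝ × ℝ), q z ∈ φ.target := by
    refine hqs.self_of_nhds.continuousAt.eventually ?_
    rw [hq0]
    exact extChartAt_target_mem_nhds _
  obtain ⟨(χ : Surface J N), hχ⟩ := exists_global (J := J) (f := fun z => φ.symm (q z)) (by
    filter_upwards [hqs, hqt] with z h1 h2
    have h3 : ContMDiffAt 𝓘(ℝ, V) J ∞ φ.symm (q z) :=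
      (contMDiffOn_extChartAt_symm p.proj).contMDiffAt
        ((isOpen_extChartAt_target p.proj).mem_nhds h2)
    exact h3.comp z h1.contMDiffAt)
  have hχq : ∀ᶠ z in 𝓝 (0 : ℝ × ℝ), φ (χ z) = q z := by
    filter_upwards [hχ, hqt] with z h1 h2
    rw [h1, φ.right_inv h2]
  have hχ0 : χ (0, 0) = p.proj := by
    have := hχ.self_of_nhds
    rw [hq0, φ.left_inv (mem_extChartAt_source _)] at this
    exact this
  have hpS : χ (0, 0) ∈ (extChartAt J p.proj).source := hχ0 ▸ mem_extChartAt_source _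
  have hev : (fun t => extChartAt J.tangent p (χ.partialS t)) =ᶠ[𝓝 0] a := by
    have hin : Tendsto (fun t : ℝ => ((0, t) : ℝ × ℝ)) (𝓝 0) (𝓝 0) :=
      (Continuous.prodMk_right (0 : ℝ)).tendsto' _ _ rfl
    filter_upwards [partialS_chart χ p hpS, hin.eventually hχq.eventually_nhds] with t h1 h2
    rw [h1]
    have hl : Tendsto (fun s : ℝ => ((s, t) : ℝ × ℝ)) (𝓝 0) (𝓝 (0, t)) :=
      (Continuous.prodMk_left t).tendsto' _ _ rfl
    have h3 : (fun s => φ (χ (s, t))) =ᶠ[𝓝 0] fun s => (a t).1 + s • (a t).2 :=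
      hl.eventually h2
    refine Prod.ext ?_ ?_
    · have h4 := h2.self_of_nhds
      simp only [hq, zero_smul, add_zero] at h4
      exact h4
    · change deriv (fun s => φ (χ (s, t))) 0 = (a t).2
      rw [h3.deriv_eq]
      simpa using (((hasDerivAt_id (0 : ℝ)).smul_const (a t).2).const_add (a t).1).deriv
  have h0 : χ.partialS 0 = p := by
    refine (extChartAt J.tangent p).injOn ?_ (mem_extChartAt_source _) hev.self_of_nhds
    rw [extChartAt_source]
    refine (TangentBundle.mem_chart_source_iff _ _).2 ?_
    rw [extChartAt_source] at hpS
    exact hpS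
  refine ⟨TangentJet.mk k χ, Quotient.sound (s := jetSetoid _ _ k) ⟨h0, fun i _ => ?_⟩⟩
  rw [h0]
  exact hev.iteratedDeriv_eq i

/-- The canonical identification `T T^k N ≃ T^k TN`. -/
def kappaEquiv [J.Boundaryless] [IsManifold J ∞ N] (k : ℕ) :
    TangentJet J N k ≃ Jet J.tangent (TangentBundle J N) k :=
  Equiv.ofBijective (kappa k) ⟨kappa_injective k, kappa_surjective k⟩

end Jets

section Anchored

variable {E : Type*} [NormedAddCommGroup E] [NormedSpace ℝ E]
  {F : Type*} [NormedAddCommGroup F] [NormedSpace ℝ F]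
  {M : Type*} [TopologicalSpace M] [ChartedSpace E M]
  {A : M → Type*} [∀ x, AddCommGroup (A x)] [∀ x, Module ℝ (A x)]
  [∀ x, TopologicalSpace (A x)] [TopologicalSpace (TotalSpace F A)] [FiberBundle F A]

variable (E F A) in
/-- The projection `τ : A → M`. -/
def bundleProj [VectorBundle ℝ F A] :
    C^∞⟮𝓘(ℝ, E).prod 𝓘(ℝ, F), TotalSpace F A; 𝓘(ℝ, E), M⟯ :=
  ⟨π F A, contMDiff_proj A⟩

variable [IsManifold 𝓘(ℝ, E) ∞ M]

variable (E F A) in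
/-- An anchor on the vector bundle `A → M`: a smooth vector bundle morphism `A → TM` over the
identity of `M`. -/
structure Anchor where
  /-- the linear maps on the fibres -/
  toFun : ∀ x : M, A x →L[ℝ] TangentSpace 𝓘(ℝ, E) x
  /-- smoothness of the map of total spaces -/
  smooth : ContMDiff (𝓘(ℝ, E).prod 𝓘(ℝ, F)) 𝓘(ℝ, E).tangent ∞
    (fun a : TotalSpace F A => (⟨a.proj, toFun a.proj a.2⟩ : TangentBundle 𝓘(ℝ, E) M))

/-- The anchor as a smooth map `A → TM` of total spaces. -/
def Anchor.total (ρ : Anchor E F A) :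
    C^∞⟮𝓘(ℝ, E).prod 𝓘(ℝ, F), TotalSpace F A; 𝓘(ℝ, E).tangent, TangentBundle 𝓘(ℝ, E) M⟯ :=
  ⟨fun a => ⟨a.proj, ρ.toFun a.proj a.2⟩, ρ.smooth⟩

variable [VectorBundle ℝ F A]

/-- A smooth curve `γ` in `A` is admissible if `ρ ∘ γ` is the tangent prolongation of `τ ∘ γ`. -/
def Anchor.IsAdmissible (ρ : Anchor E F A)
    (γ : Curve (𝓘(ℝ, E).prod 𝓘(ℝ, F)) (TotalSpace F A)) : Prop :=
  ∀ t, ρ.total (γ t) = Curve.velocity ((bundleProj E F A).comp γ) t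

variable [ContMDiffVectorBundle ∞ F A 𝓘(ℝ, E)]

/-- The set `A^{m+1} ⊆ T^m A`: `A^1 = A`, `A^2 = {Z ∈ TA | ρ (τ Z) = Tτ (Z)}` and
`A^{k+1} = TA^k ∩ T^k A` inside `T T^{k-1} A` for `k ≥ 2`, where `T^k A` is embedded in
`T T^{k-1} A` by `Jet.holonomic`. -/
def Anchor.prolong (ρ : Anchor E F A) :
    (m : ℕ) → Set (Jet (𝓘(ℝ, E).prod 𝓘(ℝ, F)) (TotalSpace F A) m)
  | 0 => univ
  | 1 => {Z | ρ.total Z.base = (Z.map 1 (bundleProj E F A)).velocity}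
  | m + 2 => Jet.holonomic (m + 1) ⁻¹' tangentSet (ρ.prolong (m + 1))

/-- The set of `m`-jets at `0` of admissible curves. -/
def Anchor.admissibleJets (ρ : Anchor E F A) (m : ℕ) :
    Set (Jet (𝓘(ℝ, E).prod 𝓘(ℝ, F)) (TotalSpace F A) m) :=
  {a | ∃ γ, ρ.IsAdmissible γ ∧ Jet.mk m γ = a}

/-- The map `T^m ρ : T^m A → T^m TM ≃ T T^m M`. -/
def Anchor.jetMap (ρ : Anchor E F A) (m : ℕ)
    (a : Jet (𝓘(ℝ, E).prod 𝓘(ℝ, F)) (TotalSpace F A) m) : TangentJet 𝓘(ℝ, E) M m :=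
  (kappaEquiv m).symm (Jet.map m ρ.total a)

/-- `S ⊆ T^m A` is a smooth subbundle of `T^m A → M` over which `(x, y, y', …, y⁽ᵐ⁾)` are
coordinates: in the coordinates `(x, y, x', y', …, x⁽ᵐ⁾, y⁽ᵐ⁾)` on `T^m A` induced by a
vector bundle chart `(x, y)` of `A`, the set `S` is the graph of a smooth map
`(x, y, y', …, y⁽ᵐ⁾) ↦ (x', …, x⁽ᵐ⁾)`. -/
def IsSmoothSubbundle {m : ℕ}
    (S : Set (Jet (𝓘(ℝ, E).prod 𝓘(ℝ, F)) (TotalSpace F A) m)) : Prop :=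
  ∀ p : TotalSpace F A, ∃ G : E × (Fin (m + 1) → F) → Fin m → E,
    ContDiffOn ℝ ∞ G
      {z | (z.1, z.2 0) ∈ (extChartAt (𝓘(ℝ, E).prod 𝓘(ℝ, F)) p).target} ∧
    ∀ γ : Curve (𝓘(ℝ, E).prod 𝓘(ℝ, F)) (TotalSpace F A),
      γ 0 ∈ (extChartAt (𝓘(ℝ, E).prod 𝓘(ℝ, F)) p).source →
      (Jet.mk m γ ∈ S ↔ ∀ i : Fin m,
        iteratedDeriv ((i : ℕ) + 1) (fun t => (extChartAt (𝓘(ℝ, E).prod 𝓘(ℝ, F)) p (γ t)).1) 0 =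
          G ((extChartAt (𝓘(ℝ, E).prod 𝓘(ℝ, F)) p (γ 0)).1, fun j =>
            iteratedDeriv j (fun t => (extChartAt (𝓘(ℝ, E).prod 𝓘(ℝ, F)) p (γ t)).2) 0) i)

end Anchored

end JetAnchor

end

/-!
In a bundle chart a curve in `A` is a pair `(x, y)`, the anchor is a map `(x, y) ↦ (x, R (x, y))`
(`Anchor.coord`), linear in `y`, and admissibility is the equation `x' = R (x, y)`
(`Anchor.total_eq_velocity_iff`). All three descriptions of `Aᵐ⁺¹ ⊆ TᵐA` amount to the condition
`SolvesToOrder R m`: at `0` the curve satisfies this equation and its derivatives up to order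
`m - 1`.

Jets of admissible curves lie in `Aᵐ⁺¹`, since translates of admissible curves are admissible, and
in the preimage of `Tᵐ⁺¹M`, since the anchor sends an admissible curve to the velocity of its
projection. Conversely, the preimage of `Tᵐ⁺¹M` satisfies the condition because there
`x ≡ d` and `R (x, y) ≡ d'` to order `m` for a curve `d` in `M`
(`Anchor.solvesToOrder_of_jetMap_mem`), and `Aᵐ⁺¹` satisfies it by induction: a vector tangent
to `Aᵐ` satisfies the equations obtained by differentiating those of `Aᵐ`
(`SolvesToOrder.of_family`, `Anchor.solvesToOrder_of_mem_prolong`).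

The cycle is closed by solving the equation. The vector field
`(x, y₀, …, yₘ) ↦ (R (x, y₀), y₁, …, yₘ, 0)` has an integral curve through every point, and
`(x, y₀)` along it solves `x' = R (x, y)` with prescribed derivatives of `y` (`exists_solution`).
The condition determines the derivatives of `x` from `x` and the derivatives of `y`
(`solvesToOrder_iff`), so a curve that satisfies it has the `m`-jet of this solution. By linearity
of `R` in `y` the solution can be reparametrised to an admissible curve on all of `ℝ`
(`Anchor.exists_isAdmissible`). Finally, the derivatives of `x` along an integral curve are the
iterated derivatives of the coordinate `x` along the vector field; these smooth functions of
`(x, y₀, …, yₘ)` exhibit `Aᵐ⁺¹` as a graph (`contDiffOn_solutionJet`).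
-/

noncomputable section

namespace JetAnchor

/-! ### Integral curves of smooth vector fields -/

section VectorFields

variable {V W : Type*} [NormedAddCommGroup V] [NormedSpace ℝ V]
  [NormedAddCommGroup W] [NormedSpace ℝ W]

/-- Integral curves of a smooth vector field are smooth. -/
theorem contDiffOn_integralCurve {X : V → V} {Ω : Set V} (hX : ContDiffOn ℝ ∞ X Ω)
    {w : ℝ → V} {I : Set ℝ} (hI : IsOpen I)
    (hw : ∀ t ∈ I, w t ∈ Ω ∧ HasDerivAt w (X (w t)) t) : ContDiffOn ℝ ∞ w I := by
  refine contDiffOn_infty.2 fun n => ?_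
  induction n with
  | zero =>
    exact contDiffOn_zero.2 fun t ht => (hw t ht).2.continuousAt.continuousWithinAt
  | succ n ih =>
    have h : ContDiffOn ℝ (n + 1) w I := by
      refine (contDiffOn_succ_iff_deriv_of_isOpen hI).2
        ⟨fun t ht => (hw t ht).2.differentiableAt.differentiableWithinAt, by simp, ?_⟩
      refine ((hX.of_le (by exact_mod_cast le_top)).comp ih fun t ht => (hw t ht).1).congr
        fun t ht => (hw t ht).2.deriv
    exact_mod_cast h

/-- A smooth vector field on an open set has a local integral curve through each point. -/
theorem exists_integralCurve [CompleteSpace V] {X : V → V} {Ω : Set V} (hΩ : IsOpen Ω)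
    (hX : ContDiffOn ℝ ∞ X Ω) {v : V} (hv : v ∈ Ω) :
    ∃ w : ℝ → V, ∃ ε > 0, w 0 = v ∧ ContDiffOn ℝ ∞ w (Metric.ball 0 ε) ∧
      ∀ t ∈ Metric.ball (0 : ℝ) ε, w t ∈ Ω ∧ HasDerivAt w (X (w t)) t := by
  have h1 : ContDiffAt ℝ 1 X v :=
    (hX.contDiffAt (hΩ.mem_nhds hv)).of_le (by exact_mod_cast le_top)
  obtain ⟨w, h0, ε, hε, hw⟩ :=
    h1.exists_forall_mem_closedBall_exists_eq_forall_mem_Ioo_hasDerivAt₀ 0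
  simp only [zero_sub, zero_add] at hw
  have hc : ContinuousAt w 0 := (hw 0 ⟨by linarith, hε⟩).continuousAt
  obtain ⟨δ, hδ, hw'⟩ := Metric.eventually_nhds_iff.1
    (hc.eventually (hΩ.mem_nhds (h0 ▸ hv)))
  have key : ∀ t ∈ Metric.ball (0 : ℝ) (min ε δ), w t ∈ Ω ∧ HasDerivAt w (X (w t)) t := by
    intro t ht
    rw [Metric.mem_ball, lt_min_iff] at ht
    refine ⟨hw' ht.2, hw t ?_⟩
    have := ht.1
    rw [Real.dist_eq, sub_zero, abs_lt] at this
    exact this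
  exact ⟨w, min ε δ, lt_min hε hδ, h0,
    contDiffOn_integralCurve hX Metric.isOpen_ball key, key⟩

/-- The derivative of a function along a vector field. -/
def lieDeriv (X : V → V) (g : V → W) : V → W := fun z => fderiv ℝ g z (X z)

theorem contDiffOn_lieDeriv_iterate {X : V → V} {Ω : Set V} (hΩ : IsOpen Ω)
    (hX : ContDiffOn ℝ ∞ X Ω) {g : V → W} (hg : ContDiffOn ℝ ∞ g Ω) (i : ℕ) :
    ContDiffOn ℝ ∞ ((lieDeriv X)^[i] g) Ω := by
  induction i with
  | zero => exact hg
  | succ i ih =>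
    rw [Function.iterate_succ_apply']
    exact (ih.fderiv_of_isOpen hΩ (by simp)).clm_apply hX

theorem iteratedDeriv_integralCurve {X : V → V} {Ω : Set V} (hΩ : IsOpen Ω)
    (hX : ContDiffOn ℝ ∞ X Ω) {g : V → W} (hg : ContDiffOn ℝ ∞ g Ω) {w : ℝ → V} {I : Set ℝ}
    (hI : IsOpen I) (hw : ∀ t ∈ I, w t ∈ Ω ∧ HasDerivAt w (X (w t)) t) (i : ℕ) :
    ∀ t ∈ I, iteratedDeriv i (fun t => g (w t)) t = (lieDeriv X)^[i] g (w t) := by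
  induction i with
  | zero => simp
  | succ i ih =>
    intro t ht
    have h : iteratedDeriv i (fun t => g (w t)) =ᶠ[𝓝 t] fun t => (lieDeriv X)^[i] g (w t) :=
      eventually_of_mem (hI.mem_nhds ht) ih
    rw [iteratedDeriv_succ, h.deriv_eq, Function.iterate_succ_apply']
    have hd := ((contDiffOn_lieDeriv_iterate hΩ hX hg i).contDiffAt
      (hΩ.mem_nhds (hw t ht).1)).differentiableAt (by simp)
    exact (hd.hasFDerivAt.comp_hasDerivAt t (hw t ht).2).deriv

end VectorFields

/-! ### Mixed partial derivatives -/

section MixedPartials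

variable {V : Type*} [NormedAddCommGroup V] [NormedSpace ℝ V]

/-- Iterated partial derivatives in `t` are iterated derivatives along the constant field
`(0, 1)`. -/
theorem iteratedDeriv_lieDeriv_const {f : ℝ × ℝ → V} {U : Set (ℝ × ℝ)} (hU : IsOpen U)
    (hf : ContDiffOn ℝ ∞ f U) (j : ℕ) {z : ℝ × ℝ} (hz : z ∈ U) :
    iteratedDeriv j (fun t => f (z.1, t)) z.2 =
      (lieDeriv (fun _ => ((0, 1) : ℝ × ℝ)))^[j] f z := by
  have hI : IsOpen {t : ℝ | (z.1, t) ∈ U} := hU.preimage (Continuous.prodMk_right z.1)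
  exact iteratedDeriv_integralCurve hU contDiffOn_const hf (w := fun t => (z.1, t)) hI
    (fun t ht => ⟨ht, (hasDerivAt_const t z.1).prodMk (hasDerivAt_id t)⟩) j z.2 hz

theorem deriv_eq_lieDeriv_const {f : ℝ × ℝ → V} {z : ℝ × ℝ} (hf : DifferentiableAt ℝ f z) :
    deriv (fun s => f (s, z.2)) z.1 = lieDeriv (fun _ => ((1, 0) : ℝ × ℝ)) f z :=
  (HasFDerivAt.comp_hasDerivAt (f := fun s => (s, z.2)) z.1 hf.hasFDerivAt
    ((hasDerivAt_id z.1).prodMk (hasDerivAt_const z.1 z.2))).deriv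

theorem lieDeriv_const_comm {X : Type*} [NormedAddCommGroup X] [NormedSpace ℝ X]
    {f : X → V} {z : X} (hf : ContDiffAt ℝ ∞ f z) (a b : X) :
    lieDeriv (fun _ => a) (lieDeriv (fun _ => b) f) z =
      lieDeriv (fun _ => b) (lieDeriv (fun _ => a) f) z := by
  have hd : DifferentiableAt ℝ (fderiv ℝ f) z :=
    (hf.fderiv_right (m := ∞) (by simp)).differentiableAt (by simp)
  have e : ∀ a b : X, lieDeriv (fun _ => a) (lieDeriv (fun _ => b) f) z =
      fderiv ℝ (fderiv ℝ f) z a b := by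
    intro a b
    change fderiv ℝ (fun y => fderiv ℝ f y b) z a = _
    rw [fderiv_clm_apply hd (differentiableAt_const b)]
    simp
  rw [e, e]
  exact hf.isSymmSndFDerivAt (by
    rw [minSmoothness_of_isRCLikeNormedField]
    exact WithTop.coe_le_coe.2 (le_top : (2 : ℕ∞) ≤ ⊤)) a b

/-- Partial derivatives commute: `∂ₛ ∂ₜʲ f = ∂ₜʲ ∂ₛ f`. -/
theorem deriv_iteratedDeriv_comm {f : ℝ × ℝ → V} {U : Set (ℝ × ℝ)} (hU : IsOpen U)
    (hf : ContDiffOn ℝ ∞ f U) (j : ℕ) {z : ℝ × ℝ} (hz : z ∈ U) :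
    deriv (fun s => iteratedDeriv j (fun t => f (s, t)) z.2) z.1 =
      iteratedDeriv j (fun t => deriv (fun s => f (s, t)) z.1) z.2 := by
  set S := lieDeriv (W := V) (fun _ => ((1, 0) : ℝ × ℝ)) with hS
  set T := lieDeriv (W := V) (fun _ => ((0, 1) : ℝ × ℝ)) with hT
  have smT : ∀ i, ContDiffOn ℝ ∞ (T^[i] f) U := fun i =>
    contDiffOn_lieDeriv_iterate hU contDiffOn_const hf i
  have smS : ContDiffOn ℝ ∞ (S f) U :=
    contDiffOn_lieDeriv_iterate hU contDiffOn_const hf 1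
  have at_ {g : ℝ × ℝ → V} (hg : ContDiffOn ℝ ∞ g U) {z} (hz : z ∈ U) : ContDiffAt ℝ ∞ g z :=
    hg.contDiffAt (hU.mem_nhds hz)
  have comm : ∀ i, ∀ z ∈ U, S (T^[i] f) z = T^[i] (S f) z := by
    intro i
    induction i with
    | zero => exact fun _ _ => rfl
    | succ i ih =>
      intro z hz
      rw [Function.iterate_succ_apply', Function.iterate_succ_apply', hS, hT,
        lieDeriv_const_comm (at_ (smT i) hz), ← hS, ← hT]
      have h : S (T^[i] f) =ᶠ[𝓝 z] T^[i] (S f) := eventually_of_mem (hU.mem_nhds hz) ih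
      exact congrArg (fun L : ℝ × ℝ →L[ℝ] V => L (0, 1)) h.fderiv_eq
  have h1 : (fun s => iteratedDeriv j (fun t => f (s, t)) z.2) =ᶠ[𝓝 z.1]
      fun s => T^[j] f (s, z.2) := by
    have : ∀ᶠ s in 𝓝 z.1, (s, z.2) ∈ U :=
      (Continuous.prodMk_left z.2).continuousAt.eventually (hU.mem_nhds hz)
    filter_upwards [this] with s hs
    exact iteratedDeriv_lieDeriv_const hU hf j hs
  have h2 : (fun t => deriv (fun s => f (s, t)) z.1) =ᶠ[𝓝 z.2] fun t => S f (z.1, t) := by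
    have : ∀ᶠ t in 𝓝 z.2, (z.1, t) ∈ U :=
      (Continuous.prodMk_right z.1).continuousAt.eventually (hU.mem_nhds hz)
    filter_upwards [this] with t ht
    exact deriv_eq_lieDeriv_const (z := (z.1, t)) ((at_ hf ht).differentiableAt (by simp))
  rw [h1.deriv_eq, h2.iteratedDeriv_eq,
    deriv_eq_lieDeriv_const ((at_ (smT j) hz).differentiableAt (by simp)),
    iteratedDeriv_lieDeriv_const hU smS j hz]
  exact comm j z hz

end MixedPartials

/-! ### The equation `x' = R (x, y)` on jets -/

section Formal

variable {E F : Type*} [NormedAddCommGroup E] [NormedSpace ℝ E]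
  [NormedAddCommGroup F] [NormedSpace ℝ F]

/-- The jet at `0` of the curve `(x, y) = u` satisfies the equation `x' = R (x, y)` and its
derivatives up to order `m - 1`. -/
def SolvesToOrder (R : E × F → E) (m : ℕ) (u : ℝ → E × F) : Prop :=
  ∀ i < m, iteratedDeriv (i + 1) (fun t => (u t).1) 0 = iteratedDeriv i (fun t => R (u t)) 0

theorem iteratedDeriv_prod {u : ℝ → E × F} {t : ℝ} (hu : ContDiffAt ℝ ∞ u t) (i : ℕ) :
    iteratedDeriv i u t =
      (iteratedDeriv i (fun t => (u t).1) t, iteratedDeriv i (fun t => (u t).2) t) :=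
  Prod.ext (iteratedDeriv_clm (ContinuousLinearMap.fst ℝ E F) hu i).symm
    (iteratedDeriv_clm (ContinuousLinearMap.snd ℝ E F) hu i).symm

/-- If `v = (x, y)` solves `x' = R (x, y)` exactly and `u` has the same value and the same jet of
the second component, then `u` is a solution to order `m` exactly when it has the `m`-jet
of `v`: the equation determines the derivatives of the first component successively. -/
theorem solvesToOrder_iff {R : E × F → E} {m : ℕ} {u v : ℝ → E × F}
    (hu : ContDiffAt ℝ ∞ u 0) (hv : ContDiffAt ℝ ∞ v 0) (hR : ContDiffAt ℝ ∞ R (u 0))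
    (h0 : u 0 = v 0)
    (hy : ∀ i ≤ m, iteratedDeriv i (fun t => (u t).2) 0 = iteratedDeriv i (fun t => (v t).2) 0)
    (hsol : deriv (fun t => (v t).1) =ᶠ[𝓝 0] fun t => R (v t)) :
    SolvesToOrder R m u ↔ ∀ i < m,
      iteratedDeriv (i + 1) (fun t => (u t).1) 0 = iteratedDeriv (i + 1) (fun t => (v t).1) 0 := by
  have hv' : ∀ i, iteratedDeriv (i + 1) (fun t => (v t).1) 0 =
      iteratedDeriv i (fun t => R (v t)) 0 := fun i => by
    rw [iteratedDeriv_succ']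
    exact hsol.iteratedDeriv_eq i
  -- equality of the `i`-jets of `u` and `v` gives equality of the `i`-jets of `R ∘ u` and `R ∘ v`
  have hcomp : ∀ i ≤ m, (∀ j < i, iteratedDeriv (j + 1) (fun t => (u t).1) 0 =
      iteratedDeriv (j + 1) (fun t => (v t).1) 0) →
      iteratedDeriv i (fun t => R (u t)) 0 = iteratedDeriv i (fun t => R (v t)) 0 := by
    intro i hi h
    have hi' : (i : WithTop ℕ∞) ≤ ∞ := by exact_mod_cast le_top
    refine iteratedDeriv_comp_congr (k := i) (hu.of_le hi') (hv.of_le hi') (hR.of_le hi')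
      (fun j hj => ?_) i le_rfl
    rw [iteratedDeriv_prod hu, iteratedDeriv_prod hv, hy j (hj.trans hi)]
    rcases j with _ | j
    · simp [h0]
    · rw [h j (by omega)]
  constructor
  · intro h i
    induction i using Nat.strong_induction_on with
    | _ i ih =>
      intro hi
      rw [h i hi, hv', hcomp i hi.le fun j hj => ih j hj (hj.trans hi)]
  · intro h i hi
    rw [h i hi, hv', hcomp i hi.le fun j hj => h j (hj.trans hi)]

/-- The vector field `(x, y₀, …, yₘ) ↦ (R (x, y₀), y₁, …, yₘ, 0)`. Along its integral curves
`yⱼ` is the `j`-th derivative of `y₀` and `x' = R (x, y₀)`. -/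
def jetField (m : ℕ) (R : E × F → E) (z : E × (Fin (m + 1) → F)) : E × (Fin (m + 1) → F) :=
  (R (z.1, z.2 0), fun j => if h : (j : ℕ) + 1 < m + 1 then z.2 ⟨j + 1, h⟩ else 0)

theorem contDiffOn_jetField {m : ℕ} {R : E × F → E} {Ω : Set (E × F)}
    (hR : ContDiffOn ℝ ∞ R Ω) :
    ContDiffOn ℝ ∞ (jetField m R) ((fun z => (z.1, z.2 0)) ⁻¹' Ω) := by
  have ev : ∀ j, ContDiff ℝ ∞ fun z : E × (Fin (m + 1) → F) => z.2 j := fun j => by fun_prop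
  refine (hR.comp (contDiff_fst.prodMk (ev 0)).contDiffOn fun _ h => h).prodMk ?_
  refine ContDiff.contDiffOn (contDiff_pi.2 fun j => ?_)
  split_ifs
  · exact ev _
  · exact contDiff_const

/-- The universal formula for the derivatives of `x` in terms of `(x, y, y', …, y⁽ᵐ⁾)`. -/
def solutionJet (m : ℕ) (R : E × F → E) (z : E × (Fin (m + 1) → F)) (i : Fin m) : E :=
  (lieDeriv (jetField m R))^[i + 1] Prod.fst z

theorem contDiffOn_solutionJet {m : ℕ} {R : E × F → E} {Ω : Set (E × F)} (hΩ : IsOpen Ω)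
    (hR : ContDiffOn ℝ ∞ R Ω) :
    ContDiffOn ℝ ∞ (solutionJet m R) ((fun z => (z.1, z.2 0)) ⁻¹' Ω) :=
  contDiffOn_pi.2 fun _ => contDiffOn_lieDeriv_iterate (hΩ.preimage (by fun_prop))
    (contDiffOn_jetField hR) contDiff_fst.contDiffOn _

/-- Through each jet `(x, y, y', …, y⁽ᵐ⁾)` there is a solution of `x' = R (x, y)`. -/
theorem exists_solution [CompleteSpace E] [CompleteSpace F] (m : ℕ) {R : E × F → E}
    {Ω : Set (E × F)} (hΩ : IsOpen Ω) (hR : ContDiffOn ℝ ∞ R Ω) {z : E × (Fin (m + 1) → F)}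
    (hz : (z.1, z.2 0) ∈ Ω) :
    ∃ v : ℝ → E × F, ∃ ε > 0, v 0 = (z.1, z.2 0) ∧ ContDiffOn ℝ ∞ v (Metric.ball 0 ε) ∧
      (∀ t ∈ Metric.ball (0 : ℝ) ε, v t ∈ Ω ∧ HasDerivAt (fun t => (v t).1) (R (v t)) t) ∧
      (∀ j : Fin (m + 1), iteratedDeriv j (fun t => (v t).2) 0 = z.2 j) ∧
      ∀ i : Fin m, iteratedDeriv (i + 1) (fun t => (v t).1) 0 = solutionJet m R z i := by
  have hΩ' : IsOpen ((fun z : E × (Fin (m + 1) → F) => (z.1, z.2 0)) ⁻¹' Ω) :=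
    hΩ.preimage (by fun_prop)
  have hX := contDiffOn_jetField (m := m) hR
  obtain ⟨w, ε, hε, h0, hs, hw⟩ := exists_integralCurve hΩ' hX (v := z) hz
  -- the components of the vector field make `yⱼ` the `j`-th derivative of `y₀`
  have hY : ∀ j : ℕ, ∀ hj : j < m + 1, ∀ t ∈ Metric.ball (0 : ℝ) ε,
      iteratedDeriv j (fun t => (w t).2 0) t = (w t).2 ⟨j, hj⟩ := by
    intro j
    induction j with
    | zero => intro hj t _; simp
    | succ j ih =>
      intro hj t ht
      have e : iteratedDeriv j (fun t => (w t).2 0) =ᶠ[𝓝 t]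
          fun t => (w t).2 ⟨j, by omega⟩ :=
        eventually_of_mem (Metric.isOpen_ball.mem_nhds ht) (ih (by omega))
      rw [iteratedDeriv_succ, e.deriv_eq]
      have hd := (hasDerivAt_pi.1 (hw t ht).2.snd) ⟨j, by omega⟩
      rw [hd.deriv]
      exact dif_pos hj
  have h0m : (0 : ℝ) ∈ Metric.ball (0 : ℝ) ε := Metric.mem_ball_self hε
  refine ⟨fun t => ((w t).1, (w t).2 0), ε, hε, by simp [h0], ?_,
    fun t ht => ⟨(hw t ht).1, (hw t ht).2.fst⟩, fun j => ?_, fun i => ?_⟩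
  · exact hs.fst.prodMk (contDiffOn_pi.1 hs.snd 0)
  · rw [hY j j.2 0 h0m, h0]
  · have := iteratedDeriv_integralCurve hΩ' hX contDiff_fst.contDiffOn Metric.isOpen_ball hw
      (i + 1) 0 h0m
    rw [h0] at this
    exact this

/-- Let `f` be a family of curves `t ↦ f (s, t)` that solve `x' = R (x, y)` to order `m + 1`. If the
velocity at `s = 0` of their `(m + 1)`-jets is that of the curves `t ↦ c (s + t)`, then `c` is a
solution to order `m + 2`: differentiate the equations in `s` and exchange `∂ₛ` and `∂ₜ`. -/
theorem SolvesToOrder.of_family {R : E × F → E} {Ω : Set (E × F)} (hΩ : IsOpen Ω)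
    (hR : ContDiffOn ℝ ∞ R Ω) {m : ℕ} {f : ℝ × ℝ → E × F} {U : Set (ℝ × ℝ)} (hU : IsOpen U)
    (hf : ContDiffOn ℝ ∞ f U) (hfΩ : MapsTo f U Ω) (h0 : (0, 0) ∈ U) {c : ℝ → E × F}
    (hc : ContDiffAt ℝ ∞ c 0)
    (h1 : ∀ j ≤ m + 1, iteratedDeriv j (fun t => f (0, t)) 0 = iteratedDeriv j c 0)
    (h2 : ∀ j ≤ m + 1, iteratedDeriv j (fun t => deriv (fun s => f (s, t)) 0) 0 =
      iteratedDeriv (j + 1) c 0)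
    (h3 : ∀ᶠ s in 𝓝 (0 : ℝ), SolvesToOrder R (m + 1) fun t => f (s, t)) :
    SolvesToOrder R (m + 2) c := by
  set u : ℝ → E × F := fun t => f (0, t) with hu
  set d : ℝ → E × F := fun t => deriv (fun s => f (s, t)) 0 with hd
  have hUt : ∀ᶠ t in 𝓝 (0 : ℝ), (0, t) ∈ U :=
    (Continuous.prodMk_right (0 : ℝ)).continuousAt.eventually (hU.mem_nhds h0)
  have hsmU : ∀ z ∈ U, ContDiffAt ℝ ∞ f z := fun z hz => hf.contDiffAt (hU.mem_nhds hz)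
  have hline : ContDiffAt ℝ ∞ (fun t : ℝ => ((0, t) : ℝ × ℝ)) 0 := by fun_prop
  have hus : ContDiffAt ℝ ∞ u 0 := (hsmU _ h0).comp (0 : ℝ) hline
  have hde : d =ᶠ[𝓝 0] fun t => lieDeriv (fun _ => ((1, 0) : ℝ × ℝ)) f (0, t) := by
    filter_upwards [hUt] with t ht
    exact deriv_eq_lieDeriv_const (z := (0, t)) ((hsmU _ ht).differentiableAt (by simp))
  have hds : ContDiffAt ℝ ∞ d 0 := by
    refine ContDiffAt.congr_of_eventuallyEq ?_ hde
    have hl : ContDiffOn ℝ ∞ (lieDeriv (fun _ => ((1, 0) : ℝ × ℝ)) f) U :=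
      contDiffOn_lieDeriv_iterate hU contDiffOn_const hf 1
    exact (hl.contDiffAt (hU.mem_nhds h0)).comp (0 : ℝ) hline
  have huc : u 0 = c 0 := by simpa using h1 0 (by omega)
  have hRc : ContDiffAt ℝ ∞ R (c 0) := hR.contDiffAt (hΩ.mem_nhds (huc ▸ hfΩ h0))
  have hc' : ContDiffAt ℝ ∞ (deriv c) 0 := by
    have h : ContDiffAt ℝ ∞ (fderiv ℝ c) 0 := hc.fderiv_right (by simp)
    exact h.clm_apply contDiffAt_const
  have hRf : ContDiffOn ℝ ∞ (fun z => R (f z)) U := hR.comp hf hfΩ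
  intro i hi
  rcases i with _ | i
  · have e := h3.self_of_nhds 0 (by omega)
    have e1 := h1 1 (by omega)
    rw [iteratedDeriv_prod hus, iteratedDeriv_prod hc] at e1
    have e2 := (Prod.ext_iff.1 e1).1
    simp only [iteratedDeriv_zero] at e e2 ⊢
    simp only [zero_add] at e ⊢
    rw [← e2, e, ← huc]
  -- the derivative of the order `i` equation in `s`
  have e : iteratedDeriv (i + 1) (fun t => deriv (fun s => (f (s, t)).1) 0) 0 =
      iteratedDeriv i (fun t => deriv (fun s => R (f (s, t))) 0) 0 := by
    rw [← deriv_iteratedDeriv_comm hU hf.fst (i + 1) h0, ← deriv_iteratedDeriv_comm hU hRf i h0]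
    refine Filter.EventuallyEq.deriv_eq ?_
    filter_upwards [h3] with s hs
    exact hs i (by omega)
  have hfd : ∀ᶠ t in 𝓝 (0 : ℝ), HasDerivAt (fun s => f (s, t)) (d t) 0 := by
    filter_upwards [hUt] with t ht
    exact (((hsmU _ ht).comp (0 : ℝ) (f := fun s : ℝ => (s, t))
      (by fun_prop)).differentiableAt (by simp)).hasDerivAt
  have eL : (fun t => deriv (fun s => (f (s, t)).1) 0) =ᶠ[𝓝 0] fun t => (d t).1 := by
    filter_upwards [hfd] with t ht
    exact (hasFDerivAt_fst.comp_hasDerivAt (0 : ℝ) ht).deriv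
  have eR : (fun t => deriv (fun s => R (f (s, t))) 0) =ᶠ[𝓝 0]
      (fun q : (E × F) × (E × F) => fderiv ℝ R q.1 q.2) ∘ fun t => (u t, d t) := by
    filter_upwards [hfd, hUt] with t ht hU'
    have hRt : DifferentiableAt ℝ R (f (0, t)) :=
      (hR.contDiffAt (hΩ.mem_nhds (hfΩ hU'))).differentiableAt (by simp)
    exact (hRt.hasFDerivAt.comp_hasDerivAt (0 : ℝ) ht).deriv
  have eC : deriv (fun t => R (c t)) =ᶠ[𝓝 0]
      (fun q : (E × F) × (E × F) => fderiv ℝ R q.1 q.2) ∘ fun t => (c t, deriv c t) := by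
    have h1' : (1 : WithTop ℕ∞) ≤ ∞ := by exact_mod_cast le_top
    filter_upwards [(hc.of_le h1').eventually (by simp),
      hc.continuousAt.eventually ((hRc.of_le h1').eventually (by simp))] with t ht hRt
    exact ((hRt.differentiableAt (by simp)).hasFDerivAt.comp_hasDerivAt t
      (ht.differentiableAt (by simp)).hasDerivAt).deriv
  have hi' : (i : WithTop ℕ∞) ≤ ∞ := by exact_mod_cast le_top
  have hg : ContDiffAt ℝ ∞ (fun q : (E × F) × (E × F) => fderiv ℝ R q.1 q.2) (u 0, d 0) := by
    have h4 : ContDiffAt ℝ ∞ (fderiv ℝ R) (u 0) := (huc ▸ hRc).fderiv_right (by simp)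
    exact (h4.comp (u 0, d 0) contDiffAt_fst).clm_apply contDiffAt_snd
  -- `∂ₛ R (f (s, t))` at `s = 0` is `DR (u) d` and `(R ∘ c)'` is `DR (c) c'`; by hypothesis
  -- `(u, d)` and `(c, c')` have the same `i`-jet at `0`
  have key := iteratedDeriv_comp_congr (k := i) ((hus.prodMk hds).of_le hi')
    ((hc.prodMk hc').of_le hi') (hg.of_le hi') (fun j hj => by
      rw [iteratedDeriv_prod (hus.prodMk hds), iteratedDeriv_prod (hc.prodMk hc'),
        h1 j (by omega), h2 j (by omega), iteratedDeriv_succ']) i le_rfl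
  have e3 := h2 (i + 1) (by omega)
  rw [iteratedDeriv_prod hds, iteratedDeriv_prod hc] at e3
  rw [iteratedDeriv_succ' (f := fun t => R (c t)), eC.iteratedDeriv_eq, ← key,
    ← eR.iteratedDeriv_eq, ← e, eL.iteratedDeriv_eq]
  exact (congrArg Prod.fst e3).symm

end Formal

/-! ### Jets and velocities in charts -/

section JetsInCharts

variable {V : Type*} [NormedAddCommGroup V] [NormedSpace ℝ V] {H : Type*} [TopologicalSpace H]
  {J : ModelWithCorners ℝ V H}
  {N : Type*} [TopologicalSpace N] [ChartedSpace H N]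

/-- Equality of derivatives up to order `k` does not depend on the chart. -/
theorem iteratedDeriv_chart_congr [J.Boundaryless] [IsManifold J ∞ N] {k : ℕ} {γ δ : Curve J N}
    {p q : N} (hp : γ 0 ∈ (extChartAt J p).source) (hq : γ 0 ∈ (extChartAt J q).source)
    (h0 : γ 0 = δ 0)
    (h : ∀ i ≤ k, iteratedDeriv i (fun t => extChartAt J p (γ t)) 0 =
      iteratedDeriv i (fun t => extChartAt J p (δ t)) 0) :
    ∀ i ≤ k, iteratedDeriv i (fun t => extChartAt J q (γ t)) 0 =
      iteratedDeriv i (fun t => extChartAt J q (δ t)) 0 := by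
  set g : V → V := fun v => extChartAt J q ((extChartAt J p).symm v) with hg
  have hgs : ContDiffAt ℝ ∞ g (extChartAt J p (γ 0)) := by
    refine contDiffAt_chart (f := fun v => (extChartAt J p).symm v) ?_ ?_
    · exact (contMDiffOn_extChartAt_symm p).contMDiffAt
        ((isOpen_extChartAt_target p).mem_nhds ((extChartAt J p).map_source hp))
    · rwa [(extChartAt J p).left_inv hp]
  have key : ∀ ε : Curve J N, ε 0 = γ 0 →
      (fun t => extChartAt J q (ε t)) =ᶠ[𝓝 0] g ∘ (fun t => extChartAt J p (ε t)) := by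
    intro ε hε
    filter_upwards [eventually_mem_source ε.contMDiff.continuous.continuousAt (hε ▸ hp)] with t ht
    simp only [hg, Function.comp_apply, (extChartAt J p).left_inv ht]
  have hk : (k : WithTop ℕ∞) ≤ ∞ := by exact_mod_cast le_top
  have hsm : ∀ ε : Curve J N, ε 0 = γ 0 →
      ContDiffAt ℝ k (fun t => extChartAt J p (ε t)) 0 := fun ε hε =>
    (contDiffAt_chart ε.contMDiff.contMDiffAt (hε ▸ hp)).of_le hk
  intro i hi
  rw [(key γ rfl).iteratedDeriv_eq i, (key δ h0.symm).iteratedDeriv_eq i]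
  exact iteratedDeriv_comp_congr (hsm γ rfl) (hsm δ h0.symm) (hgs.of_le hk) h i hi

theorem mem_source_tangent [IsManifold J ∞ N] {p q : TangentBundle J N} :
    q ∈ (extChartAt J.tangent p).source ↔ q.proj ∈ (extChartAt J p.proj).source := by
  rw [extChartAt_source, extChartAt_source]
  exact TangentBundle.mem_chart_source_iff q p

/-- Equality of mixed derivatives does not depend on the chart. -/
theorem mixedDeriv_chart_congr [J.Boundaryless] [IsManifold J ∞ N] {k : ℕ} {χ ξ : Surface J N}
    (h : tangentJetSetoid J N k χ ξ) {p : N} (hp : χ (0, 0) ∈ (extChartAt J p).source)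
    {i j : ℕ} (hi : i ≤ 1) (hj : j ≤ k) : mixedDeriv J p i j χ = mixedDeriv J p i j ξ := by
  let p' : TangentBundle J N := ⟨p, 0⟩
  have hs : χ.partialS 0 ∈ (extChartAt J.tangent p').source := mem_source_tangent.2 hp
  have hc := partialS_congr h
  have e := iteratedDeriv_chart_congr (mem_extChartAt_source _) hs hc.1 hc.2 j hj
  rw [partialS_iteratedDeriv χ p' hp, partialS_iteratedDeriv ξ p' (h.1 ▸ hp)] at e
  interval_cases i
  · exact (Prod.ext_iff.1 e).1
  · exact (Prod.ext_iff.1 e).2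

theorem velocity_chart [IsManifold J ∞ N] (δ : Curve J N) (p : TangentBundle J N) {t : ℝ}
    (ht : δ t ∈ (extChartAt J p.proj).source) :
    extChartAt J.tangent p (δ.velocity t) =
      (extChartAt J p.proj (δ t), deriv (fun t => extChartAt J p.proj (δ t)) t) := by
  have ht' : δ t ∈ (chartAt H p.proj).source := by rwa [extChartAt_source] at ht
  rw [extChartAt_tangent p (δ.velocity t) ht']
  refine Prod.ext rfl ?_
  have : IsManifold J 1 N := IsManifold.of_le (n := ∞) (by exact_mod_cast le_top)
  have e := mfderiv_comp t (mdifferentiableAt_extChartAt (I := J) ht')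
    (δ.contMDiff.contMDiffAt.mdifferentiableAt (by simp))
  rw [mfderiv_eq_fderiv] at e
  exact (congrArg (fun L : ℝ →L[ℝ] V => L 1) e).symm

/-- The tangent vector `∂ₛ γ (s + t)` at `s = 0` is the velocity of `γ`. -/
theorem partialS_shift [IsManifold J ∞ N] (γ : Curve J N) (t : ℝ) :
    γ.shift.partialS t = γ.velocity t := by
  have e : mfderiv 𝓘(ℝ, ℝ × ℝ) J γ.shift (0, t) =
      (mfderiv 𝓘(ℝ, ℝ) J γ (0 + t)).comp
        (ContinuousLinearMap.fst ℝ ℝ ℝ + ContinuousLinearMap.snd ℝ ℝ ℝ) := by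
    have hs : HasFDerivAt (fun z : ℝ × ℝ => z.1 + z.2)
        (ContinuousLinearMap.fst ℝ ℝ ℝ + ContinuousLinearMap.snd ℝ ℝ ℝ) (0, t) :=
      hasFDerivAt_fst.add hasFDerivAt_snd
    have := mfderiv_comp (I := 𝓘(ℝ, ℝ × ℝ)) (I' := 𝓘(ℝ, ℝ)) (I'' := J) (g := γ)
      (f := fun z : ℝ × ℝ => z.1 + z.2) (0, t)
      (γ.contMDiff.contMDiffAt.mdifferentiableAt (by simp))
      hs.hasMFDerivAt.mdifferentiableAt
    rw [hs.hasMFDerivAt.mfderiv] at this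
    exact this
  have e1 : γ.shift.partialS t = γ.velocity (0 + t) := by
    change (⟨γ (0 + t), mfderiv 𝓘(ℝ, ℝ × ℝ) J γ.shift (0, t) ((1, 0) : ℝ × ℝ)⟩ :
      TangentBundle J N) = ⟨γ (0 + t), mfderiv 𝓘(ℝ, ℝ) J γ (0 + t) (1 : ℝ)⟩
    rw [e]
    congr 1
    exact congrArg (mfderiv 𝓘(ℝ, ℝ) J γ (0 + t)) (add_zero (1 : ℝ))
  rw [e1, zero_add]

theorem velocity_shift_slice [IsManifold J ∞ N] (γ : Curve J N) (s t : ℝ) :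
    (γ.shift.slice s).velocity t = γ.velocity (s + t) := by
  have hs : HasFDerivAt (fun r : ℝ => s + r) (ContinuousLinearMap.id ℝ ℝ) t :=
    (hasFDerivAt_id t).const_add s
  have e := mfderiv_comp (I := 𝓘(ℝ, ℝ)) (I' := 𝓘(ℝ, ℝ)) (I'' := J) (g := γ)
    (f := fun r : ℝ => s + r) t
    (γ.contMDiff.contMDiffAt.mdifferentiableAt (by simp)) hs.hasMFDerivAt.mdifferentiableAt
  rw [hs.hasMFDerivAt.mfderiv] at e
  change (⟨γ (s + t), mfderiv 𝓘(ℝ, ℝ) J (γ.shift.slice s) t (1 : ℝ)⟩ : TangentBundle J N) =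
    ⟨γ (s + t), mfderiv 𝓘(ℝ, ℝ) J γ (s + t) (1 : ℝ)⟩
  congr 1
  exact congrArg (fun L : ℝ →L[ℝ] V => L 1) e

end JetsInCharts

/-! ### The anchor and admissible curves in charts -/

section AnchorInCharts

variable {E : Type*} [NormedAddCommGroup E] [NormedSpace ℝ E]
  {F : Type*} [NormedAddCommGroup F] [NormedSpace ℝ F]
  {M : Type*} [TopologicalSpace M] [ChartedSpace E M]
  {A : M → Type*} [∀ x, TopologicalSpace (A x)] [TopologicalSpace (TotalSpace F A)] [FiberBundle F A]

theorem proj_mem_source {p a : TotalSpace F A}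
    (ha : a ∈ (extChartAt (𝓘(ℝ, E).prod 𝓘(ℝ, F)) p).source) :
    a.proj ∈ (extChartAt 𝓘(ℝ, E) p.proj).source := by
  rw [FiberBundle.extChartAt, PartialEquiv.trans_source] at ha
  have h := ha.2.1
  have e : ((trivializationAt F A p.proj) a).1 = a.proj := Trivialization.coe_fst _ ha.1
  change ((trivializationAt F A p.proj) a).1 ∈ _ at h
  rwa [e] at h

theorem extChartAt_fst {p a : TotalSpace F A}
    (ha : a ∈ (extChartAt (𝓘(ℝ, E).prod 𝓘(ℝ, F)) p).source) :
    (extChartAt (𝓘(ℝ, E).prod 𝓘(ℝ, F)) p a).1 = extChartAt 𝓘(ℝ, E) p.proj a.proj := by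
  rw [FiberBundle.extChartAt, PartialEquiv.trans_source] at ha
  rw [FiberBundle.extChartAt]
  have e : ((trivializationAt F A p.proj) a).1 = a.proj := Trivialization.coe_fst _ ha.1
  change extChartAt 𝓘(ℝ, E) p.proj ((trivializationAt F A p.proj) a).1 = _
  rw [e]

variable [∀ x, AddCommGroup (A x)] [∀ x, Module ℝ (A x)] [IsManifold 𝓘(ℝ, E) ∞ M]

/-- The anchor in charts: the map `(x, y) ↦ R (x, y)` such that the anchor is
`(x, y) ↦ (x, R (x, y))` in the bundle chart around `p` and the corresponding chart of `TM`. -/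
def Anchor.coord (ρ : Anchor E F A) (p : TotalSpace F A) (z : E × F) : E :=
  (extChartAt 𝓘(ℝ, E).tangent (ρ.total p)
    (ρ.total ((extChartAt (𝓘(ℝ, E).prod 𝓘(ℝ, F)) p).symm z))).2

theorem total_mem_source (ρ : Anchor E F A) {p a : TotalSpace F A}
    (ha : a ∈ (extChartAt (𝓘(ℝ, E).prod 𝓘(ℝ, F)) p).source) :
    ρ.total a ∈ (extChartAt 𝓘(ℝ, E).tangent (ρ.total p)).source := by
  have h := proj_mem_source ha
  exact mem_source_tangent.2 h

theorem Anchor.total_chart (ρ : Anchor E F A) {p a : TotalSpace F A}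
    (ha : a ∈ (extChartAt (𝓘(ℝ, E).prod 𝓘(ℝ, F)) p).source) :
    extChartAt 𝓘(ℝ, E).tangent (ρ.total p) (ρ.total a) =
      ((extChartAt (𝓘(ℝ, E).prod 𝓘(ℝ, F)) p a).1,
        ρ.coord p (extChartAt (𝓘(ℝ, E).prod 𝓘(ℝ, F)) p a)) := by
  refine Prod.ext ?_ ?_
  · rw [extChartAt_fst ha]
    rfl
  · rw [Anchor.coord, (extChartAt _ p).left_inv ha]

variable [VectorBundle ℝ F A]

theorem Anchor.coord_smul (ρ : Anchor E F A) (p : TotalSpace F A) (c : ℝ) {z : E × F}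
    (hz : z ∈ (extChartAt (𝓘(ℝ, E).prod 𝓘(ℝ, F)) p).target) :
    ρ.coord p (z.1, c • z.2) = c • ρ.coord p z := by
  have hz' := hz
  rw [FiberBundle.extChartAt_target] at hz'
  obtain ⟨⟨hx, hb⟩, -⟩ := hz'
  set b := (extChartAt 𝓘(ℝ, E) p.proj).symm z.1 with hbdef
  have hbs : b ∈ (chartAt E p.proj).source := by
    rw [← extChartAt_source 𝓘(ℝ, E)]
    exact (extChartAt 𝓘(ℝ, E) p.proj).map_target hx
  have e : ∀ y : F, ρ.coord p (z.1, y) =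
      (mfderiv 𝓘(ℝ, E) 𝓘(ℝ, E) (extChartAt 𝓘(ℝ, E) p.proj) b
        (ρ.toFun b ((trivializationAt F A p.proj).symmₗ ℝ b y)) : E) := by
    intro y
    have h1 : (extChartAt (𝓘(ℝ, E).prod 𝓘(ℝ, F)) p).symm (z.1, y) =
        (⟨b, (trivializationAt F A p.proj).symm b y⟩ : TotalSpace F A) := by
      rw [Trivialization.mk_symm _ hb, FiberBundle.extChartAt]
      rfl
    rw [Anchor.coord, h1, extChartAt_tangent _ _ hbs, Trivialization.symmₗ_apply _ hb]
    rfl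
  rw [e, show ρ.coord p z = _ from e z.2, map_smul, map_smul]
  exact map_smul (mfderiv 𝓘(ℝ, E) 𝓘(ℝ, E) (extChartAt 𝓘(ℝ, E) p.proj) b) c _

/-- In charts, a curve is admissible exactly when `x' = R (x, y)`. -/
theorem Anchor.total_eq_velocity_iff (ρ : Anchor E F A) {p : TotalSpace F A}
    (γ : Curve (𝓘(ℝ, E).prod 𝓘(ℝ, F)) (TotalSpace F A)) {t : ℝ}
    (ht : γ t ∈ (extChartAt (𝓘(ℝ, E).prod 𝓘(ℝ, F)) p).source) :
    ρ.total (γ t) = Curve.velocity ((bundleProj E F A).comp γ) t ↔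
      deriv (fun t => (extChartAt (𝓘(ℝ, E).prod 𝓘(ℝ, F)) p (γ t)).1) t =
        ρ.coord p (extChartAt (𝓘(ℝ, E).prod 𝓘(ℝ, F)) p (γ t)) := by
  set δ := (bundleProj E F A).comp γ with hδ
  have hδt : δ t ∈ (extChartAt 𝓘(ℝ, E) (ρ.total p).proj).source := proj_mem_source ht
  have hd : (fun t => (extChartAt (𝓘(ℝ, E).prod 𝓘(ℝ, F)) p (γ t)).1) =ᶠ[𝓝 t]
      fun t => extChartAt 𝓘(ℝ, E) (ρ.total p).proj (δ t) := by
    filter_upwards [eventually_mem_source γ.contMDiff.continuous.continuousAt ht] with r hr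
    exact extChartAt_fst hr
  rw [← (extChartAt 𝓘(ℝ, E).tangent (ρ.total p)).injOn.eq_iff (total_mem_source ρ ht)
      (mem_source_tangent.2 hδt), velocity_chart δ _ hδt, ρ.total_chart ht, hd.deriv_eq,
    extChartAt_fst ht]
  exact ⟨fun h => (Prod.ext_iff.1 h).2.symm, fun h => Prod.ext rfl h.symm⟩

variable [ContMDiffVectorBundle ∞ F A 𝓘(ℝ, E)]

theorem Anchor.contDiffOn_coord (ρ : Anchor E F A) (p : TotalSpace F A) :
    ContDiffOn ℝ ∞ (ρ.coord p) (extChartAt (𝓘(ℝ, E).prod 𝓘(ℝ, F)) p).target := by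
  intro z hz
  have h1 : ContMDiffAt 𝓘(ℝ, E × F) (𝓘(ℝ, E).prod 𝓘(ℝ, F)) ∞
      (extChartAt (𝓘(ℝ, E).prod 𝓘(ℝ, F)) p).symm z := by
    have := (contMDiffOn_extChartAt_symm (I := 𝓘(ℝ, E).prod 𝓘(ℝ, F)) (n := ∞) p).contMDiffAt
      ((isOpen_extChartAt_target p).mem_nhds hz)
    exact this
  have h2 := contDiffAt_chart (p := ρ.total p) (ρ.total.contMDiff.contMDiffAt.comp z h1)
    (total_mem_source ρ ((extChartAt _ p).map_target hz))
  exact h2.snd.contDiffWithinAt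

/-- A local solution of `x' = R (x, y)` extends, after restriction to a neighbourhood of `0`, to
an admissible curve on `ℝ`. It is reparametrised by a function `θ` with values in its domain that is
the identity near `0`, and `y` is multiplied by `θ'`, as the linearity of the anchor in `y`
allows. -/
theorem Anchor.exists_isAdmissible (ρ : Anchor E F A) (p : TotalSpace F A) {v : ℝ → E × F}
    {ε : ℝ} (hε : 0 < ε) (hs : ContDiffOn ℝ ∞ v (Metric.ball 0 ε))
    (hv : ∀ t ∈ Metric.ball (0 : ℝ) ε, v t ∈ (extChartAt (𝓘(ℝ, E).prod 𝓘(ℝ, F)) p).target ∧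
      HasDerivAt (fun t => (v t).1) (ρ.coord p (v t)) t) :
    ∃ γ, ρ.IsAdmissible γ ∧ γ 0 = (extChartAt (𝓘(ℝ, E).prod 𝓘(ℝ, F)) p).symm (v 0) ∧
      (fun t => extChartAt (𝓘(ℝ, E).prod 𝓘(ℝ, F)) p (γ t)) =ᶠ[𝓝 0] v := by
  let b : ContDiffBump (0 : ℝ) := ⟨ε / 2, ε, by positivity, by linarith⟩
  set θ : ℝ → ℝ := fun t => b t * t with hθ
  have hθs : ContDiff ℝ ∞ θ := b.contDiff.mul contDiff_id
  have hθm : ∀ t, θ t ∈ Metric.ball (0 : ℝ) ε := by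
    intro t
    by_cases ht : dist t 0 < ε
    · rw [mem_ball_zero_iff, norm_mul, Real.norm_of_nonneg b.nonneg]
      rw [dist_zero_right] at ht
      exact (mul_le_of_le_one_left (norm_nonneg _) b.le_one).trans_lt ht
    · rw [hθ]
      simp only
      rw [b.zero_of_le_dist (not_lt.1 ht), zero_mul]
      exact Metric.mem_ball_self hε
  have hθ1 : θ =ᶠ[𝓝 0] id := by
    filter_upwards [b.eventuallyEq_one] with t ht
    simp [hθ, ht]
  have hθd : ContDiff ℝ ∞ (deriv θ) := (contDiff_infty_iff_deriv.1 hθs).2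
  have hvθ : ContDiff ℝ ∞ fun t => v (θ t) := contDiff_iff_contDiffAt.2 fun t =>
    (hs.contDiffAt (Metric.isOpen_ball.mem_nhds (hθm t))).comp t hθs.contDiffAt
  set u : ℝ → E × F := fun t => ((v (θ t)).1, deriv θ t • (v (θ t)).2) with hu
  have hus : ContDiff ℝ ∞ u := hvθ.fst.prodMk (hθd.smul hvθ.snd)
  have hut : ∀ t, u t ∈ (extChartAt (𝓘(ℝ, E).prod 𝓘(ℝ, F)) p).target := by
    intro t
    have := (hv _ (hθm t)).1
    rw [FiberBundle.extChartAt_target] at this ⊢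
    exact ⟨this.1, mem_univ _⟩
  have huv : u =ᶠ[𝓝 0] v := by
    filter_upwards [hθ1.eventually_nhds] with t ht
    have h1 : θ t = t := ht.self_of_nhds
    have h2 : deriv θ t = 1 := by rw [Filter.EventuallyEq.deriv_eq ht, deriv_id]
    simp [hu, h1, h2]
  let γ : Curve (𝓘(ℝ, E).prod 𝓘(ℝ, F)) (TotalSpace F A) :=
    ⟨fun t => (extChartAt (𝓘(ℝ, E).prod 𝓘(ℝ, F)) p).symm (u t), fun t =>
      ContMDiffAt.comp (I' := 𝓘(ℝ, E × F)) t
        ((contMDiffOn_extChartAt_symm (I := 𝓘(ℝ, E).prod 𝓘(ℝ, F)) (n := ∞) p).contMDiffAt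
          ((isOpen_extChartAt_target p).mem_nhds (hut t)))
        hus.contMDiff.contMDiffAt⟩
  have hγu : ∀ t, extChartAt (𝓘(ℝ, E).prod 𝓘(ℝ, F)) p (γ t) = u t := fun t =>
    (extChartAt _ p).right_inv (hut t)
  refine ⟨γ, fun t => ?_, ?_, ?_⟩
  · rw [ρ.total_eq_velocity_iff (p := p) γ ((extChartAt _ p).map_target (hut t))]
    simp only [hγu]
    -- the chain rule and `R (x, θ' y) = θ' R (x, y)`
    have h := (hv _ (hθm t)).2.scomp t
      (hθs.differentiable (by simp)).differentiableAt.hasDerivAt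
    exact h.deriv.trans (ρ.coord_smul p _ (hv _ (hθm t)).1).symm
  · exact congrArg (extChartAt (𝓘(ℝ, E).prod 𝓘(ℝ, F)) p).symm huv.self_of_nhds
  · simp only [hγu]
    exact huv

end AnchorInCharts

/-! ### The three descriptions of the prolongations -/

section Prolongations

variable {E : Type*} [NormedAddCommGroup E] [NormedSpace ℝ E]
  {F : Type*} [NormedAddCommGroup F] [NormedSpace ℝ F]
  {M : Type*} [TopologicalSpace M] [ChartedSpace E M]
  {A : M → Type*} [∀ x, AddCommGroup (A x)] [∀ x, Module ℝ (A x)]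
  [∀ x, TopologicalSpace (A x)] [TopologicalSpace (TotalSpace F A)] [FiberBundle F A]
  [IsManifold 𝓘(ℝ, E) ∞ M] [VectorBundle ℝ F A]

theorem Anchor.IsAdmissible.shift_slice {ρ : Anchor E F A}
    {γ : Curve (𝓘(ℝ, E).prod 𝓘(ℝ, F)) (TotalSpace F A)} (hγ : ρ.IsAdmissible γ) (s : ℝ) :
    ρ.IsAdmissible (γ.shift.slice s) := fun t =>
  (hγ (s + t)).trans (velocity_shift_slice ((bundleProj E F A).comp γ) s t).symm

variable [ContMDiffVectorBundle ∞ F A 𝓘(ℝ, E)]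

theorem Anchor.admissibleJets_subset_prolong (ρ : Anchor E F A) (m : ℕ) :
    ρ.admissibleJets m ⊆ ρ.prolong m := by
  induction m with
  | zero => exact fun _ _ => mem_univ _
  | succ m ih =>
    rintro _ ⟨γ, hγ, rfl⟩
    rcases m with _ | m
    · exact hγ 0
    · exact ⟨γ.shift, fun s => ih ⟨_, hγ.shift_slice s, rfl⟩, rfl⟩

/-- The image of the jet of `γ` lies in `Tᵐ⁺¹M` exactly when the curve `ρ ∘ γ` in `TM` has the
`m`-jet of the velocity of some curve `δ` in `M`. -/
theorem Anchor.jetMap_mem_range_iff (ρ : Anchor E F A) (m : ℕ)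
    (γ : Curve (𝓘(ℝ, E).prod 𝓘(ℝ, F)) (TotalSpace F A)) :
    ρ.jetMap m (Jet.mk m γ) ∈ range (Jet.holonomic m) ↔
      ∃ δ : Curve 𝓘(ℝ, E) M, jetSetoid 𝓘(ℝ, E).tangent (TangentBundle 𝓘(ℝ, E) M) m
        δ.shift.partialS (ρ.total.comp γ) := by
  have key : ∀ δ : Curve 𝓘(ℝ, E) M,
      Jet.holonomic m (Jet.mk (m + 1) δ) = ρ.jetMap m (Jet.mk m γ) ↔
        jetSetoid 𝓘(ℝ, E).tangent (TangentBundle 𝓘(ℝ, E) M) m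
          δ.shift.partialS (ρ.total.comp γ) := by
    intro δ
    rw [Anchor.jetMap, Equiv.eq_symm_apply]
    exact Quotient.eq (r := jetSetoid _ _ m)
  constructor
  · rintro ⟨⟨δ⟩, h⟩
    exact ⟨δ, (key δ).1 h⟩
  · rintro ⟨δ, h⟩
    exact ⟨Jet.mk (m + 1) δ, (key δ).2 h⟩

theorem Anchor.admissibleJets_subset_preimage (ρ : Anchor E F A) (m : ℕ) :
    ρ.admissibleJets m ⊆ ρ.jetMap m ⁻¹' range (Jet.holonomic m) := by
  rintro _ ⟨γ, hγ, rfl⟩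
  refine (ρ.jetMap_mem_range_iff m γ).2 ⟨(bundleProj E F A).comp γ, ?_⟩
  have e : (Curve.shift ((bundleProj E F A).comp γ)).partialS = ρ.total.comp γ :=
    ContMDiffMap.ext fun t => (partialS_shift _ t).trans (hγ t).symm
  rw [e]

/-- If `ρ ∘ γ` has the `m`-jet of the velocity of `δ`, compare `x` with `δ` and `R (x, y)` with
`δ'` in the chart. -/
theorem Anchor.solvesToOrder_of_jetMap_mem (ρ : Anchor E F A) {m : ℕ}
    {γ : Curve (𝓘(ℝ, E).prod 𝓘(ℝ, F)) (TotalSpace F A)}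
    (h : ρ.jetMap m (Jet.mk m γ) ∈ range (Jet.holonomic m)) {p : TotalSpace F A}
    (hp : γ 0 ∈ (extChartAt (𝓘(ℝ, E).prod 𝓘(ℝ, F)) p).source) :
    SolvesToOrder (ρ.coord p) m
      fun t => extChartAt (𝓘(ℝ, E).prod 𝓘(ℝ, F)) p (γ t) := by
  obtain ⟨δ, hδ⟩ := (ρ.jetMap_mem_range_iff m γ).1 h
  have hs : (ρ.total.comp γ) 0 ∈ (extChartAt 𝓘(ℝ, E).tangent (ρ.total p)).source :=
    total_mem_source ρ hp
  have hs' : δ.shift.partialS 0 ∈ (extChartAt 𝓘(ℝ, E).tangent (ρ.total p)).source :=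
    hδ.1 ▸ hs
  have hj := iteratedDeriv_chart_congr (mem_extChartAt_source _) hs' hδ.1 hδ.2
  set c : ℝ → E × F := fun t => extChartAt (𝓘(ℝ, E).prod 𝓘(ℝ, F)) p (γ t) with hc
  have hcs : ContDiffAt ℝ ∞ c 0 := contDiffAt_chart γ.contMDiff.contMDiffAt hp
  have hRc : ContDiffAt ℝ ∞ (fun t => ρ.coord p (c t)) 0 :=
    ((ρ.contDiffOn_coord p).contDiffAt ((isOpen_extChartAt_target p).mem_nhds
      ((extChartAt _ p).map_source hp))).comp (g := ρ.coord p) (f := c) (0 : ℝ) hcs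
  have hρ : (fun t => extChartAt 𝓘(ℝ, E).tangent (ρ.total p) ((ρ.total.comp γ) t)) =ᶠ[𝓝 0]
      fun t => ((c t).1, ρ.coord p (c t)) := by
    filter_upwards [eventually_mem_source γ.contMDiff.continuous.continuousAt hp] with t ht
    exact ρ.total_chart ht
  have key : ∀ j ≤ m, iteratedDeriv j (fun t => extChartAt 𝓘(ℝ, E) p.proj (δ t)) 0 =
        iteratedDeriv j (fun t => (c t).1) 0 ∧
      iteratedDeriv (1 + j) (fun t => extChartAt 𝓘(ℝ, E) p.proj (δ t)) 0 =
        iteratedDeriv j (fun t => ρ.coord p (c t)) 0 := by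
    intro j hjm
    have e := hj j hjm
    rw [partialS_iteratedDeriv δ.shift _ (mem_source_tangent.1 hs'), mixedDeriv_shift,
      mixedDeriv_shift, hρ.iteratedDeriv_eq, iteratedDeriv_prod (hcs.fst.prodMk hRc),
      zero_add] at e
    exact ⟨(Prod.ext_iff.1 e).1, (Prod.ext_iff.1 e).2⟩
  intro i hi
  rw [← (key (i + 1) hi).1, ← (key i hi.le).2, add_comm]

/-- Induction on `m`: an element of the next prolongation is the velocity of a family of jets in the
previous one, to which `SolvesToOrder.of_family` applies. -/
theorem Anchor.solvesToOrder_of_mem_prolong (ρ : Anchor E F A) {m : ℕ}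
    {γ : Curve (𝓘(ℝ, E).prod 𝓘(ℝ, F)) (TotalSpace F A)}
    (h : Jet.mk m γ ∈ ρ.prolong m) {p : TotalSpace F A}
    (hp : γ 0 ∈ (extChartAt (𝓘(ℝ, E).prod 𝓘(ℝ, F)) p).source) :
    SolvesToOrder (ρ.coord p) m
      fun t => extChartAt (𝓘(ℝ, E).prod 𝓘(ℝ, F)) p (γ t) := by
  induction m generalizing γ with
  | zero => exact fun i hi => absurd hi (Nat.not_lt_zero i)
  | succ m ih =>
    rcases m with _ | m
    · intro i hi
      obtain rfl : i = 0 := by omega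
      rw [zero_add, iteratedDeriv_one, iteratedDeriv_zero]
      exact (ρ.total_eq_velocity_iff γ hp).1 h
    · obtain ⟨χ, hχ, hz⟩ := h
      have hsim : tangentJetSetoid _ _ (m + 1) χ γ.shift := Quotient.exact hz
      have h00 : χ (0, 0) = γ 0 := hsim.1.trans (shift_zero γ)
      have hj : ∀ j ≤ m + 1, ∀ i ≤ 1, mixedDeriv (𝓘(ℝ, E).prod 𝓘(ℝ, F)) p i j χ =
          iteratedDeriv (i + j)
            (fun t => extChartAt (𝓘(ℝ, E).prod 𝓘(ℝ, F)) p (γ t)) 0 := by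
        intro j hj i hi
        rw [← mixedDeriv_shift]
        exact mixedDeriv_chart_congr hsim (h00 ▸ hp) hi hj
      have hU : IsOpen (χ ⁻¹' (extChartAt (𝓘(ℝ, E).prod 𝓘(ℝ, F)) p).source) :=
        (isOpen_extChartAt_source p).preimage χ.contMDiff.continuous
      have h0U : ((0, 0) : ℝ × ℝ) ∈ χ ⁻¹' (extChartAt (𝓘(ℝ, E).prod 𝓘(ℝ, F)) p).source := by
        rw [mem_preimage, h00]
        exact hp
      refine SolvesToOrder.of_family (isOpen_extChartAt_target p) (ρ.contDiffOn_coord p)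
        (f := fun z => extChartAt (𝓘(ℝ, E).prod 𝓘(ℝ, F)) p (χ z)) hU
        (fun z hz => (contDiffAt_chart χ.contMDiff.contMDiffAt hz).contDiffWithinAt)
        (fun z hz => (extChartAt _ p).map_source hz) h0U
        (contDiffAt_chart γ.contMDiff.contMDiffAt hp) (fun j hjm => ?_) (fun j hjm => ?_) ?_
      · have := hj j hjm 0 (by omega)
        simpa only [mixedDeriv, iteratedDeriv_zero, zero_add] using this
      · have := hj j hjm 1 le_rfl
        simpa only [mixedDeriv, iteratedDeriv_one, add_comm 1 j] using this
      · have : ∀ᶠ s in 𝓝 (0 : ℝ),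
            (s, (0 : ℝ)) ∈ χ ⁻¹' (extChartAt (𝓘(ℝ, E).prod 𝓘(ℝ, F)) p).source :=
          (Continuous.prodMk_left (0 : ℝ)).continuousAt.eventually (hU.mem_nhds h0U)
        filter_upwards [this] with s hs
        have hs' : (χ.slice s) 0 ∈ (extChartAt (𝓘(ℝ, E).prod 𝓘(ℝ, F)) p).source := hs
        have h' := ih (hχ s) hs'
        exact h'

/-- For each curve `γ = (x, y)` in `A` there is an admissible curve, namely the solution with the
same `(x, y, y', …, y⁽ᵐ⁾)` at `0`, whose `m`-jet is that of `γ` as soon as `γ` satisfies the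
equations `x' = R (x, y)` to order `m`; and `γ` does so exactly when the derivatives of `x` are the
functions `solutionJet` of the other coordinates. -/
theorem Anchor.exists_isAdmissible_solutionJet [CompleteSpace E] [CompleteSpace F]
    (ρ : Anchor E F A) (m : ℕ)
    (γ : Curve (𝓘(ℝ, E).prod 𝓘(ℝ, F)) (TotalSpace F A)) {p : TotalSpace F A}
    (hp : γ 0 ∈ (extChartAt (𝓘(ℝ, E).prod 𝓘(ℝ, F)) p).source) :
    ∃ δ, ρ.IsAdmissible δ ∧
      (SolvesToOrder (ρ.coord p) m (fun t => extChartAt (𝓘(ℝ, E).prod 𝓘(ℝ, F)) p (γ t)) →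
        Jet.mk m δ = Jet.mk m γ) ∧
      (SolvesToOrder (ρ.coord p) m (fun t => extChartAt (𝓘(ℝ, E).prod 𝓘(ℝ, F)) p (γ t)) ↔
        ∀ i : Fin m, iteratedDeriv ((i : ℕ) + 1)
          (fun t => (extChartAt (𝓘(ℝ, E).prod 𝓘(ℝ, F)) p (γ t)).1) 0 =
            solutionJet m (ρ.coord p) ((extChartAt (𝓘(ℝ, E).prod 𝓘(ℝ, F)) p (γ 0)).1, fun j =>
              iteratedDeriv j
                (fun t => (extChartAt (𝓘(ℝ, E).prod 𝓘(ℝ, F)) p (γ t)).2) 0) i) := by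
  set c : ℝ → E × F := fun t => extChartAt (𝓘(ℝ, E).prod 𝓘(ℝ, F)) p (γ t) with hc
  have hcs : ContDiffAt ℝ ∞ c 0 := contDiffAt_chart γ.contMDiff.contMDiffAt hp
  have hct : c 0 ∈ (extChartAt (𝓘(ℝ, E).prod 𝓘(ℝ, F)) p).target :=
    (extChartAt _ p).map_source hp
  have hR := ρ.contDiffOn_coord p
  obtain ⟨v, ε, hε, hv0, hvs, hv, hvy, hvx⟩ := exists_solution m (isOpen_extChartAt_target p) hR
    (z := ((c 0).1, fun j : Fin (m + 1) => iteratedDeriv j (fun t => (c t).2) 0))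
    (by simpa only [Fin.val_zero, iteratedDeriv_zero] using hct)
  have hv0' : v 0 = c 0 := by simpa using hv0
  have hb : Metric.ball (0 : ℝ) ε ∈ 𝓝 0 := Metric.ball_mem_nhds 0 hε
  have hy : ∀ i ≤ m, iteratedDeriv i (fun t => (c t).2) 0 =
      iteratedDeriv i (fun t => (v t).2) 0 := fun i hi => (hvy ⟨i, by omega⟩).symm
  have hiff := solvesToOrder_iff (m := m) hcs (hvs.contDiffAt hb)
    (hR.contDiffAt ((isOpen_extChartAt_target p).mem_nhds hct)) hv0'.symm hy
    (eventually_of_mem hb fun t ht => (hv t ht).2.deriv)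
  obtain ⟨δ, hδ, hδ0, hδv⟩ := ρ.exists_isAdmissible p hε hvs hv
  refine ⟨δ, hδ, fun h => ?_, hiff.trans ⟨fun h i => (h i i.2).trans (hvx i), fun h i hi =>
    (h ⟨i, hi⟩).trans (hvx ⟨i, hi⟩).symm⟩⟩
  have h0 : δ 0 = γ 0 := by
    rw [hδ0, hv0']
    exact (extChartAt _ p).left_inv hp
  have hx := hiff.1 h
  refine Quotient.sound (s := jetSetoid _ _ m) ⟨h0, ?_⟩
  refine iteratedDeriv_chart_congr (p := p) (h0 ▸ hp) (mem_extChartAt_source _) h0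
    fun i hi => ?_
  rw [hδv.iteratedDeriv_eq]
  change iteratedDeriv i v 0 = iteratedDeriv i c 0
  rw [iteratedDeriv_prod (hvs.contDiffAt hb), iteratedDeriv_prod hcs, hy i hi]
  rcases i with _ | i
  · simp [hv0']
  · rw [hx i hi]

end Prolongations

end JetAnchor

end

theorem mainTheorem1
    {E : Type*} [NormedAddCommGroup E] [NormedSpace ℝ E] [FiniteDimensional ℝ E]
    {F : Type*} [NormedAddCommGroup F] [NormedSpace ℝ F] [FiniteDimensional ℝ F]
    {M : Type*} [TopologicalSpace M] [ChartedSpace E M] [IsManifold 𝓘(ℝ, E) ∞ M]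
    {A : M → Type*} [∀ x, AddCommGroup (A x)] [∀ x, Module ℝ (A x)]
    [∀ x, TopologicalSpace (A x)] [TopologicalSpace (TotalSpace F A)]
    [FiberBundle F A] [VectorBundle ℝ F A] [ContMDiffVectorBundle ∞ F A 𝓘(ℝ, E)]
    (ρ : JetAnchor.Anchor E F A) (m : ℕ) :
    JetAnchor.IsSmoothSubbundle (ρ.prolong m) ∧
      ρ.prolong m = ρ.admissibleJets m ∧
      ρ.prolong m = ρ.jetMap m ⁻¹' range (JetAnchor.Jet.holonomic m) := by
  have := FiniteDimensional.complete ℝ E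
  have := FiniteDimensional.complete ℝ F
  have hadm : ∀ (γ : JetAnchor.Curve (𝓘(ℝ, E).prod 𝓘(ℝ, F)) (TotalSpace F A))
      {p : TotalSpace F A}, γ 0 ∈ (extChartAt (𝓘(ℝ, E).prod 𝓘(ℝ, F)) p).source →
      JetAnchor.SolvesToOrder (ρ.coord p) m
        (fun t => extChartAt (𝓘(ℝ, E).prod 𝓘(ℝ, F)) p (γ t)) →
      JetAnchor.Jet.mk m γ ∈ ρ.admissibleJets m := by
    intro γ p hp h
    obtain ⟨δ, hδ, hjet, -⟩ := ρ.exists_isAdmissible_solutionJet m γ hp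
    exact ⟨δ, hδ, hjet h⟩
  have h1 : ρ.prolong m ⊆ ρ.admissibleJets m := by
    rintro ⟨γ⟩ h
    exact hadm γ (mem_extChartAt_source _) (ρ.solvesToOrder_of_mem_prolong h
      (mem_extChartAt_source _))
  have h2 : ρ.jetMap m ⁻¹' range (JetAnchor.Jet.holonomic m) ⊆ ρ.admissibleJets m := by
    rintro ⟨γ⟩ h
    exact hadm γ (mem_extChartAt_source _) (ρ.solvesToOrder_of_jetMap_mem h
      (mem_extChartAt_source _))
  have e1 := h1.antisymm (ρ.admissibleJets_subset_prolong m)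
  refine ⟨fun p => ⟨JetAnchor.solutionJet m (ρ.coord p),
    JetAnchor.contDiffOn_solutionJet (isOpen_extChartAt_target p) (ρ.contDiffOn_coord p),
    fun γ hp => ?_⟩, e1, e1.trans ((ρ.admissibleJets_subset_preimage m).antisymm h2)⟩
  obtain ⟨-, -, -, hiff⟩ := ρ.exists_isAdmissible_solutionJet m γ hp
  rw [← hiff]
  exact ⟨fun h => ρ.solvesToOrder_of_mem_prolong h hp,
    fun h => ρ.admissibleJets_subset_prolong m (hadm γ hp h)⟩
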